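/- All graphs are finite and simple. For a set $S$ of nodes of $G$, $\alpha(S)$ is the independence number of $G[S]$, and $\Gamma_G[S]$ is the closed neighbourhood of $S$. A *clique forest* of a chordal graph $G$ is a forest $\mathcal T$ whose vertices are the maximal cliques of $G$ and in which, for every node $v$, the cliques containing $v$ induce a tree. A *binary path* in a forest is a path whose vertices all have degree at most $2$ in the forest. A maximal binary path is *pendant* if one of its end vertices has degree $1$ or it is a single isolated vertex, and *internal* if all its vertices have degree $2$. **Algorithm.** The input is a chordal graph $G=(V,E)$ with a clique forest $\mathcal T$, and $\varepsilon\in(0,1/2)$. Let $d=\lceil 64/\varepsilon\rceil$, $k=\lceil\log_2(d/\varepsilon)+2\rceil$, $U_1=V$, $\mathcal T_1=\mathcal T$, $I=\emptyset$. For $i=1,\dots,k$, writing $G_i=G[U_i]$: 1. Let $\mathcal L_i$ be the set of all maximal binary paths of $\mathcal T_i$ that are pendant, together with those internal ones $\mathcal P$ for which: if $i<k$, the maximum distance in $G_i$ between two nodes of cliques of $\mathcal P$ is at least $2d+3$; if $i=k$, the independence number of the subgraph induced by the nodes of the cliques of $\mathcal P$ is at least $d$. 2. For $\mathcal P\in\mathcal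 L_i$ let $W_{\mathcal P}$ be the set of nodes $w\in U_i$ such that all cliques of $\mathcal T_i$ containing $w$ lie on $\mathcal P$. For every connected component $H$ of $G_i[W_{\mathcal P}\setminus\Gamma_G[I]]$ choose an independent set $I_H$ of $H$ as follows. If $\alpha(H)\ge d$, then $I_H$ is any independent set with $\alpha(H)\le(1+\varepsilon/8)|I_H|$. If $\alpha(H)<d$, then $I_H$ is any maximum independent set of $H$ which, if $i<k$, is moreover *absorbing*, i.e. $|I_H|=\alpha(\Gamma_{G_i}[I_H]\setminus\Gamma_G[I])$. Let $I_{\mathcal P}=\bigcup_H I_H$. 3. Let $U_{i+1}=U_i\setminus\bigcup_{\mathcal P\in\mathcal L_i}W_{\mathcal P}$; if $i<k$, let $\mathcal T_{i+1}$ be obtained from $\mathcal T_i$ by deleting all paths in $\mathcal L_i$. Add $\bigcup_{\mathcal P\in\mathcal L_i}I_{\mathcal P}$ to $I$ (the set $I$ is updated only here, at the end of the iteration). Return $I$. **Theorem.** The number of iterations satisfies $k=O(\log\frac1\varepsilon)$, i.e. there is an absolute constant $K>0$ with $k\le K\log\frac1\varepsilon$ for all $\varepsilon\in(0,1/2)$.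 Moreover, for every $\varepsilon\in(0,1/2)$, every chordal graph $G$ and every clique forest $\mathcal T$ of $G$, whatever choices the algorithm makes: * the algorithm never gets stuck, i.e. in every iteration all the required sets $I_H$ exist; * for every $i\le k$ and $\mathcal P\in\mathcal L_i$ we have $\alpha(V_{\mathcal P})\le(1+\frac{\varepsilon}{4})\,|I_{\mathcal P}|$, where, with $I$ denoting the set at the start of iteration $i$, $V_{\mathcal P}=(W_{\mathcal P}\cup\Gamma_{G_i}[I_{\mathcal P}])\setminus\Gamma_G[I]$ if $i<k$ and $V_{\mathcal P}=W_{\mathcal P}\setminus\Gamma_G[I]$ if $i=k$; * after the $k$ iterations, $\alpha(G[U_{k+1}])\le\frac{\varepsilon}{2}\,\alpha(G)$; * the returned set $I$ is independent in $G$ and $\alpha(G)\le(1+\varepsilon)\,|I|$. -/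

import Mathlib

open Set

namespace ChordalMIS

noncomputable section

/-! ### Graph notions -/

/-- Every cycle of length at least four has a chord: an edge between two nodes of the cycle
that is not an edge of the cycle. -/
def IsChordal {V : Type*} (G : SimpleGraph V) : Prop :=
  ∀ (v : V) (c : G.Walk v v), c.IsCycle → 4 ≤ c.length →
    ∃ x ∈ c.support, ∃ y ∈ c.support, G.Adj x y ∧ s(x, y) ∉ c.edges

/-- The independence number `α(S) = α(G[S])` of a set `S` of nodes. -/
def alpha {V : Type*} (G : SimpleGraph V) (S : Set V) : ℕ :=
  (G.induce S).indepNum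

/-- The closed neighbourhood of `S` in the induced subgraph `G[U]`. -/
def closedNbhd {V : Type*} (G : SimpleGraph V) (U S : Set V) : Set V :=
  {v | v ∈ U ∧ (v ∈ S ∨ ∃ w ∈ S, G.Adj w v)}

/-- `H` is the node set of a maximal connected subgraph of `G[A]`. -/
def IsComponent {V : Type*} (G : SimpleGraph V) (A H : Set V) : Prop :=
  ∃ K : (G.induce A).ConnectedComponent, H = Subtype.val '' K.supp

/-- The distance of two nodes in `G[U]` (`⊤` if they are not connected in `G[U]`). -/
def distIn {V : Type*} (G : SimpleGraph V) (U : Set V) (u v : V) : ℕ∞ :=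
  (G.induce U).spanningCoe.edist u v

/-- The family of maximal cliques of `G`. -/
abbrev MaxClique {V : Type*} (G : SimpleGraph V) : Type _ :=
  {C : Set V // Maximal G.IsClique C}

/-- A clique forest of `G`: a forest on the maximal cliques of `G` such that for every node `v`
the maximal cliques that contain `v` induce a tree. -/
def IsCliqueForest {V : Type*} (G : SimpleGraph V) (T : SimpleGraph (MaxClique G)) : Prop :=
  T.IsAcyclic ∧ ∀ v : V, (T.induce {C : MaxClique G | v ∈ C.1}).IsTree

/-! ### Binary paths in a subforest `F` of a forest `T` -/

/-- The degree of `C` in `F`. -/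
def deg {W : Type*} {T : SimpleGraph W} (F : T.Subgraph) (C : W) : ℕ :=
  (F.neighborSet C).ncard

/-- `P` is the vertex set of a path in `F` with end vertices `a` and `b`. -/
def IsPathBetween {W : Type*} {T : SimpleGraph W} (F : T.Subgraph) (a b : W) (P : Set W) : Prop :=
  ∃ p : T.Walk a b, p.IsPath ∧ p.toSubgraph ≤ F ∧ P = {C | C ∈ p.support}

/-- A binary path: a path all of whose vertices have degree at most two in `F`. -/
def IsBinaryPath {W : Type*} {T : SimpleGraph W} (F : T.Subgraph) (P : Set W) : Prop :=
  (∃ a b, IsPathBetween F a b P) ∧ ∀ C ∈ P, deg F C ≤ 2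

/-- A binary path that is contained in no larger binary path. -/
def IsMaximalBinaryPath {W : Type*} {T : SimpleGraph W} (F : T.Subgraph) (P : Set W) : Prop :=
  Maximal (IsBinaryPath F) P

/-- A maximal pendant path: a maximal binary path one of whose end vertices has degree one,
or which consists of a single isolated vertex. -/
def IsMaximalPendantPath {W : Type*} {T : SimpleGraph W} (F : T.Subgraph) (P : Set W) : Prop :=
  IsMaximalBinaryPath F P ∧
    ((∃ a b, IsPathBetween F a b P ∧ (deg F a = 1 ∨ deg F b = 1)) ∨
      ∃ a, P = {a} ∧ deg F a = 0)

/-- A maximal internal path: a maximal binary path all of whose vertices have degree two. -/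
def IsMaximalInternalPath {W : Type*} {T : SimpleGraph W} (F : T.Subgraph) (P : Set W) : Prop :=
  IsMaximalBinaryPath F P ∧ ∀ C ∈ P, deg F C = 2

/-- The nodes that belong to some clique of `P`. -/
def nodesOf {V : Type*} {G : SimpleGraph V} (P : Set (MaxClique G)) : Set V :=
  {v | ∃ C ∈ P, v ∈ C.1}

/-- The diameter of a path `P`: the maximum distance in `G[U]` between nodes of cliques in `P`. -/
def pathDiam {V : Type*} (G : SimpleGraph V) (U : Set V) (P : Set (MaxClique G)) : ℕ∞ :=
  ⨆ u ∈ nodesOf P, ⨆ v ∈ nodesOf P, distIn G U u v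

/-- The independence number of a path. -/
def pathAlpha {V : Type*} (G : SimpleGraph V) (P : Set (MaxClique G)) : ℕ :=
  alpha G (nodesOf P)

/-! ### The algorithm -/

/-- `d = ⌈64 / ε⌉`. -/
def dParam (ε : ℝ) : ℕ := ⌈64 / ε⌉₊

/-- The number of iterations `k = ⌈log₂ (d / ε) + 2⌉`. -/
def kParam (ε : ℝ) : ℕ := ⌈Real.logb 2 ((dParam ε : ℝ) / ε) + 2⌉₊

/-- The data of the algorithm between two iterations: the set `U` of remaining nodes, the current
forest `F` (a subforest of the clique forest `T`), and the independent set `I` found so far. -/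
structure State {V : Type*} (G : SimpleGraph V) (T : SimpleGraph (MaxClique G)) where
  U : Set V
  F : T.Subgraph
  I : Set V

/-- At the start, no node is removed, the forest is the whole of `T`, and `I` is empty. -/
def initState {V : Type*} (G : SimpleGraph V) (T : SimpleGraph (MaxClique G)) : State G T :=
  ⟨univ, ⊤, ∅⟩

variable {V : Type*} {G : SimpleGraph V} {T : SimpleGraph (MaxClique G)}

/-- The set of paths that are peeled off in iteration `i`. -/
def layer (ε : ℝ) (i : ℕ) (s : State G T) : Set (Set (MaxClique G)) :=
  {P | IsMaximalPendantPath s.F P ∨ (IsMaximalInternalPath s.F P ∧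
    ((i < kParam ε ∧ ((2 * dParam ε + 3 : ℕ) : ℕ∞) ≤ pathDiam G s.U P) ∨
      (i = kParam ε ∧ dParam ε ≤ pathAlpha G P)))}

/-- `W_P`: the remaining nodes `w` whose tree in the current forest (the subtree formed by the
cliques of the current forest that contain `w`) is contained in the path `P`. -/
def pathNodes (s : State G T) (P : Set (MaxClique G)) : Set V :=
  {w | w ∈ s.U ∧ ∀ C ∈ s.F.verts, w ∈ C.1 → C ∈ P}

/-- The nodes of `W_P` that are not in the closed neighbourhood in `G` of the current `I`. -/
def freeNodes (s : State G T) (P : Set (MaxClique G)) : Set V :=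
  pathNodes s P \ closedNbhd G univ s.I

/-- `J` is an independent set that the algorithm may compute in iteration `i` for the connected
piece `H`. If `α(H) < d`, it is a maximum independent set of `H`, which in addition is absorbing
if `i < k`: the closed neighbourhood of `J` in `G[U]`, without that of the current `I` in `G`, has
independence number `|J|`. If `α(H) ≥ d`, it is any `(1 + ε/8)`-approximate maximum independent
set of `H`. -/
def IsAllowedPiece (ε : ℝ) (i : ℕ) (s : State G T) (H J : Set V) : Prop :=
  J ⊆ H ∧ G.IsIndepSet J ∧
    (alpha G H < dParam ε →
      J.ncard = alpha G H ∧
        (i < kParam ε → J.ncard = alpha G (closedNbhd G s.U J \ closedNbhd G univ s.I))) ∧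
    (dParam ε ≤ alpha G H → (alpha G H : ℝ) ≤ (1 + ε / 8) * (J.ncard : ℝ))

/-- The choices `c P H` of independent sets, one for each peeled path `P` and each maximal
connected subgraph `H` of the graph induced by the free nodes of `P`, are all allowed. -/
def IsAllowedChoice (ε : ℝ) (i : ℕ) (s : State G T)
    (c : Set (MaxClique G) → Set V → Set V) : Prop :=
  ∀ P ∈ layer ε i s, ∀ H, IsComponent G (freeNodes s P) H → IsAllowedPiece ε i s H (c P H)

/-- `I_P`: the union of the independent sets chosen for the maximal connected subgraphs. -/
def pathSet (s : State G T) (c : Set (MaxClique G) → Set V → Set V)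
    (P : Set (MaxClique G)) : Set V :=
  {v | ∃ H, IsComponent G (freeNodes s P) H ∧ v ∈ c P H}

/-- The state after iteration `i`. The forest is not updated in the last iteration. -/
def nextState (ε : ℝ) (i : ℕ) (s : State G T) (c : Set (MaxClique G) → Set V → Set V) :
    State G T where
  U := s.U \ ⋃ P ∈ layer ε i s, pathNodes s P
  F := open Classical in if i < kParam ε then s.F.deleteVerts (⋃₀ layer ε i s) else s.F
  I := s.I ∪ ⋃ P ∈ layer ε i s, pathSet s c P

variable (G T) in
/-- `Reaches G T ε i s`: some execution of the algorithm on `G` with clique forest `T` is in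
state `s` after its first `i ≤ k` iterations. -/
inductive Reaches (ε : ℝ) : ℕ → State G T → Prop
  | init : Reaches ε 0 (initState G T)
  | step (i : ℕ) (s : State G T) (c : Set (MaxClique G) → Set V → Set V) :
      Reaches ε i s → i < kParam ε → IsAllowedChoice ε (i + 1) s c →
      Reaches ε (i + 1) (nextState ε (i + 1) s c)

/-- `V_P`: the nodes accounted for by the path `P` in iteration `i`. It is
`(W_P ∪ Γ_{G[U]}[I_P]) \ Γ_G[I]` if `i < k`, and `W_P \ Γ_G[I]` if `i = k`. -/
def chargedNodes (ε : ℝ) (i : ℕ) (s : State G T) (c : Set (MaxClique G) → Set V → Set V)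
    (P : Set (MaxClique G)) : Set V :=
  {v | (v ∈ pathNodes s P ∨ (i < kParam ε ∧ v ∈ closedNbhd G s.U (pathSet s c P))) ∧
    v ∉ closedNbhd G univ s.I}

end

end ChordalMIS

/-!
The argument works with subtrees of the clique forest: a node corresponds to the subtree of the
cliques that contain it, two nodes are adjacent iff their subtrees meet, and a set that is covered
by `n` cliques has independence number at most `n`.

*Structure.* The maximal binary paths of the current forest are pairwise disjoint and their outer
neighbours are branch vertices (`IsMaximalBinaryPath.three_le_deg`). While the forest is updated,
it stays induced, the remaining nodes are those of the remaining cliques, their subtrees stay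
connected, and adjacent remaining nodes keep a common clique (`IsRegular`). The point is that no
internal path of large diameter is covered by the subtrees of a node or of two adjacent nodes: a
short chain of nodes whose subtrees cover a path bounds its diameter
(`IsCliqueForest.pathDiam_le`, `IsRegular.exit_unique`).

*Absorbing sets.* On a path the subtrees are intervals. The greedy independent set of a piece `H`,
taken from one end of the path, has as many elements as it has right ends, and these pierce all
intervals of `H` and all intervals that reach the other end from a neighbour
(`exists_disjoint_pierced`, `IsRegular.exists_absorbing_of_end`). So it is absorbing if nodes
leave the path from neighbours of `H` at one end only. This holds for pendant paths, and for
internal paths if `α(H) < d`, since otherwise a shortest path through `H`, which has fewer than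
`2 α(H)` edges (`dist_lt_two_mul_indepNum`), would bound the diameter of the path
(`IsRegular.exists_absorbing`). If `α(H) ≥ d`, the charged nodes outside `H` lie in the two end
cliques of the path and cost at most `2`, which is at most `ε / 8` times the size of the chosen set
(`IsRegular.alpha_pieceNodes_le`).

*Remaining nodes.* Leaves and branch vertices of the next forest are branch vertices of the current
one, and a forest has at least as many leaves as branch vertices, so every iteration halves the
number of branch vertices (`two_mul_branchCount_nextState_le`); initially it is at most `α(G)`, as
every leaf has a private node. In the last iteration all remaining nodes lie in one of `b` branch
vertices or on one of at most `b` internal paths of independence number less than `d`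
(`ncard_internal_le`), and `b d ≤ (ε / 2) α(G)` by the choice of `k`.

*Conclusion.* Every node is removed or dominated first by some path, to which it is charged, unless
it remains at the end (`compl_nextState_subset`, `covered_nextState_subset`). Hence
`α(G) ≤ (ε / 2) α(G) + (1 + ε / 4) |I|`, and `1 + ε / 4 ≤ (1 - ε / 2) (1 + ε)`.
-/

namespace ChordalMIS

/-! ### Independence numbers -/

section Alpha

variable {V : Type*} {G : SimpleGraph V}

lemma ncard_le_alpha [Finite V] {S J : Set V} (hJS : J ⊆ S) (hJ : G.IsIndepSet J) :
    J.ncard ≤ alpha G S := by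
  classical
  have := Fintype.ofFinite V
  set t : Finset S := Finset.univ.filter fun x : S => (x : V) ∈ J
  have ht : (G.induce S).IsIndepSet (t : Set S) := by
    intro x hx y hy hxy
    simp only [t, Finset.coe_filter, mem_ofPred_eq] at hx hy
    exact hJ hx.2 hy.2 (fun h => hxy (Subtype.ext h))
  have hcard : J.ncard = t.card := by
    rw [← Set.ncard_coe_finset t,
      ← Set.ncard_image_of_injective (t : Set S) Subtype.val_injective]
    congr 1
    ext x
    simp only [t, Finset.coe_filter, mem_image, mem_ofPred_eq, Finset.mem_univ, true_and]
    exact ⟨fun h => ⟨⟨x, hJS h⟩, h, rfl⟩, by rintro ⟨y, hy, rfl⟩; exact hy⟩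
  rw [hcard]
  exact ht.card_le_indepNum

lemma exists_isIndepSet_ncard_eq_alpha [Finite V] (G : SimpleGraph V) (S : Set V) :
    ∃ J ⊆ S, G.IsIndepSet J ∧ J.ncard = alpha G S := by
  obtain ⟨t, ht, hc⟩ := (G.induce S).exists_isNIndepSet_indepNum
  refine ⟨Subtype.val '' (t : Set S), by simp, ?_, ?_⟩
  · rintro _ ⟨x, hx, rfl⟩ _ ⟨y, hy, rfl⟩ hxy
    exact ht hx hy (fun h => hxy (congrArg _ h))
  · rw [Set.ncard_image_of_injective _ Subtype.val_injective, Set.ncard_coe_finset, hc, alpha]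

lemma alpha_mono [Finite V] {S S' : Set V} (h : S ⊆ S') : alpha G S ≤ alpha G S' := by
  obtain ⟨J, hJ, hi, hc⟩ := exists_isIndepSet_ncard_eq_alpha G S
  exact hc ▸ ncard_le_alpha (hJ.trans h) hi

lemma alpha_univ [Finite V] : alpha G univ = G.indepNum := by
  apply le_antisymm
  · obtain ⟨J, -, hi, hc⟩ := exists_isIndepSet_ncard_eq_alpha G univ
    have hf := J.toFinite
    rw [← hc, Set.ncard_eq_toFinset_card J hf]
    exact SimpleGraph.IsIndepSet.card_le_indepNum (by simpa using hi)
  · obtain ⟨t, ht, hc⟩ := G.exists_isNIndepSet_indepNum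
    rw [← hc, ← Set.ncard_coe_finset t]
    exact ncard_le_alpha (subset_univ _) ht

lemma alpha_iUnion_le [Finite V] {ι : Type*} [Fintype ι] (S : ι → Set V) :
    alpha G (⋃ i, S i) ≤ ∑ i, alpha G (S i) := by
  obtain ⟨J, hJ, hi, hc⟩ := exists_isIndepSet_ncard_eq_alpha G (⋃ i, S i)
  have hJ' : J = ⋃ i, J ∩ S i := by rw [← inter_iUnion, inter_eq_left.2 hJ]
  rw [← hc, hJ']
  refine (Set.ncard_iUnion_le_of_fintype _).trans (Finset.sum_le_sum fun i _ => ?_)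
  exact ncard_le_alpha inter_subset_right (hi.mono inter_subset_left)

lemma alpha_union_le [Finite V] (S S' : Set V) : alpha G (S ∪ S') ≤ alpha G S + alpha G S' := by
  have := alpha_iUnion_le (G := G) (fun b : Bool => cond b S S')
  rw [← union_eq_iUnion] at this
  simpa using this

lemma alpha_le_one [Finite V] {S : Set V} (hS : G.IsClique S) : alpha G S ≤ 1 := by
  obtain ⟨J, hJ, hi, hc⟩ := exists_isIndepSet_ncard_eq_alpha G S
  rw [← hc, Set.ncard_le_one_iff]
  intro x y hx hy
  by_contra hxy
  exact hi hx hy hxy (hS (hJ hx) (hJ hy) hxy)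

/-- A set covered by cliques indexed by `J` has independence number at most `|J|`. -/
lemma alpha_le_ncard_of_cover [Finite V] {ι : Type*} [Finite ι] {S : Set V} (J : Set ι)
    (K : ι → Set V) (hK : ∀ j ∈ J, G.IsClique (K j)) (hS : ∀ v ∈ S, ∃ j ∈ J, v ∈ K j) :
    alpha G S ≤ J.ncard := by
  classical
  have := Fintype.ofFinite J
  have hsub : S ⊆ ⋃ j : J, K j := fun v hv => by
    obtain ⟨j, hj, hv⟩ := hS v hv
    exact mem_iUnion.2 ⟨⟨j, hj⟩, hv⟩
  refine (alpha_mono hsub).trans ((alpha_iUnion_le _).trans ?_)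
  refine (Finset.sum_le_sum fun (j : J) _ => alpha_le_one (hK j.1 j.2)).trans ?_
  rw [Finset.sum_const, smul_eq_mul, mul_one, Finset.card_univ, ← Nat.card_eq_fintype_card,
    Nat.card_coe_set_eq]

end Alpha

/-! ### Greedy piercing of intervals -/

/-- Greedy algorithm for intervals: a finite family of nonempty intervals `S h` of natural numbers
contains a pairwise disjoint subfamily `J` whose right ends meet every interval of the family. -/
lemma exists_disjoint_pierced {α : Type*} (S : α → Set ℕ) (r : α → ℕ)
    (hS : ∀ a, (S a).OrdConnected) (H : Finset α) (hr : ∀ a ∈ H, IsGreatest (S a) (r a)) :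
    ∃ J ⊆ H, (∀ a ∈ J, ∀ b ∈ J, a ≠ b → Disjoint (S a) (S b)) ∧
      ∀ a ∈ H, ∃ j ∈ J, r j ∈ S a := by
  classical
  induction H using Finset.strongInduction with
  | H H ih =>
    rcases H.eq_empty_or_nonempty with rfl | hne
    · exact ⟨∅, by simp, by simp, by simp⟩
    obtain ⟨h, hh, hmin⟩ := H.exists_min_image r hne
    have hlt : H.filter (fun a => r h ∉ S a) ⊂ H := by
      refine (Finset.filter_ssubset).2 ⟨h, hh, ?_⟩
      simpa using (hr h hh).1
    obtain ⟨J, hJ, hdis, hpierce⟩ := ih _ hlt fun a ha => hr a (Finset.mem_filter.1 ha).1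
    have key : ∀ a ∈ J, Disjoint (S h) (S a) := by
      intro a ha
      obtain ⟨haH, hna⟩ := Finset.mem_filter.1 (hJ ha)
      rw [Set.disjoint_left]
      intro i hi hia
      exact hna ((hS a).out hia (hr a haH).1 ⟨(hr h hh).2 hi, hmin a haH⟩)
    refine ⟨insert h J, ?_, ?_, ?_⟩
    · exact Finset.insert_subset hh (hJ.trans (Finset.filter_subset _ _))
    · intro a ha b hb hab
      rcases Finset.mem_insert.1 ha with ha' | ha <;> rcases Finset.mem_insert.1 hb with hb' | hb
      · exact absurd (ha'.trans hb'.symm) hab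
      · exact ha' ▸ key b hb
      · exact hb' ▸ (key a ha).symm
      · exact hdis a ha b hb hab
    · intro a ha
      by_cases hra : r h ∈ S a
      · exact ⟨h, Finset.mem_insert_self _ _, hra⟩
      · obtain ⟨j, hj, hja⟩ := hpierce a (Finset.mem_filter.2 ⟨ha, hra⟩)
        exact ⟨j, Finset.mem_insert_of_mem hj, hja⟩

/-! ### Forests -/

section Forest

variable {W : Type*}

/-- A forest has a height function for which every vertex has at most one lower neighbour, and
neighbours have different heights: the distance to a root of its connected component. -/
lemma _root_.SimpleGraph.IsAcyclic.exists_height {A : SimpleGraph W} (hA : A.IsAcyclic) :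
    ∃ ht : W → ℕ, (∀ u v, A.Adj u v → ht u ≠ ht v) ∧
      ∀ u u' v, A.Adj u v → A.Adj u' v → ht u < ht v → ht u' < ht v → u = u' := by
  let root : W → W := fun v => (A.connectedComponentMk v).nonempty_supp.some
  have hroot : ∀ v, A.Reachable (root v) v := fun v =>
    SimpleGraph.ConnectedComponent.exact (A.connectedComponentMk v).nonempty_supp.some_mem
  have hadj : ∀ u v, A.Adj u v → root u = root v := fun u v h => by
    simp only [root]
    congr! 2
    exact SimpleGraph.ConnectedComponent.sound h.reachable
  refine ⟨fun v => A.dist (root v) v, fun u v h => ?_, fun u u' v h h' hlt hlt' => ?_⟩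
  · dsimp only
    rw [← hadj u v h]
    exact hA.dist_ne_of_adj h (hroot u)
  · obtain ⟨p, hp, hpl⟩ := (hroot v).exists_path_of_dist
    -- A lower neighbour is the last but one vertex of the path from the root.
    have key : ∀ w, A.Adj w v → A.dist (root w) w < A.dist (root v) v → w = p.penultimate := by
      intro w hw hl
      rw [hadj w v hw] at hl
      have hreach : A.Reachable (root v) w := (hadj w v hw) ▸ hroot w
      obtain ⟨q, hq, hql⟩ := hreach.exists_path_of_dist
      refine hA.eq_penultimate_of_adj_end hp hw.symm ?_
      by_contra hnot
      have hv := hA.mem_support_of_ne_mem_support_of_adj_of_isPath hq hp hw hnot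
      have := hA.path_concat hp hq hw.symm hv
      rw [this, SimpleGraph.Walk.length_concat] at hql
      omega
    rw [key u h hlt, key u' h' hlt']

/-- In a finite forest there are at most as many vertices of degree at least three as leaves. -/
lemma _root_.SimpleGraph.IsAcyclic.ncard_branch_le [Finite W] {A : SimpleGraph W}
    (hA : A.IsAcyclic) :
    {v | 3 ≤ (A.neighborSet v).ncard}.ncard ≤ {v | (A.neighborSet v).ncard = 1}.ncard := by
  classical
  have := Fintype.ofFinite W
  obtain ⟨ht, hne, huniq⟩ := hA.exists_height
  have hdeg : ∀ v, (A.neighborSet v).ncard = A.degree v := fun v => by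
    rw [← A.card_neighborSet_eq_degree, Set.ncard_eq_toFinset_card', Set.toFinset_card]
  simp only [hdeg]
  -- Sending an edge to its upper end is injective on edges.
  have hedges : A.edgeFinset.card ≤ (Finset.univ.filter fun v => 1 ≤ A.degree v).card := by
    -- The last case of the definition, equal heights, does not occur for edges.
    let up : Sym2 W → W := Sym2.lift ⟨fun u v => if ht u < ht v then v else if ht v < ht u then u
      else (s(u, v)).out.1, fun u v => by
        dsimp only
        rcases lt_trichotomy (ht u) (ht v) with h | h | h
        · simp [h, h.not_gt]
        · simp [h, Sym2.eq_swap]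
        · simp [h, h.not_gt]⟩
    have hup : ∀ e ∈ A.edgeFinset, ∃ u v, e = s(u, v) ∧ A.Adj u v ∧ ht u < ht v ∧ up e = v := by
      intro e
      induction e with
      | h u v =>
        intro he
        rw [SimpleGraph.mem_edgeFinset, SimpleGraph.mem_edgeSet] at he
        rcases lt_or_gt_of_ne (hne u v he) with h | h
        · exact ⟨u, v, rfl, he, h, by simp [up, h]⟩
        · exact ⟨v, u, Sym2.eq_swap, he.symm, h, by simp [up, h, h.not_gt]⟩
    refine Finset.card_le_card_of_injOn up (fun e he => ?_) (fun e he e' he' heq => ?_)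
    · obtain ⟨u, v, -, huv, -, h⟩ := hup e he
      simp only [h, Finset.coe_filter, Finset.mem_univ, true_and, mem_ofPred_eq]
      exact (A.degree_pos_iff_exists_adj v).2 ⟨u, huv.symm⟩
    · obtain ⟨u, v, rfl, huv, hl, h⟩ := hup e he
      obtain ⟨u', v', rfl, huv', hl', h'⟩ := hup e' he'
      obtain rfl : v = v' := by rw [← h, ← h', heq]
      rw [huniq u u' v huv huv' hl hl']
  have hsum := A.sum_degrees_eq_twice_card_edges
  have hpt : ∀ v, 2 * (if 1 ≤ A.degree v then 1 else 0) + (if 3 ≤ A.degree v then 1 else 0) ≤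
      A.degree v + (if A.degree v = 1 then 1 else 0) := by
    intro v
    split_ifs <;> omega
  have hs := Finset.sum_le_sum fun v (_ : v ∈ Finset.univ) => hpt v
  simp only [Finset.sum_add_distrib, ← Finset.mul_sum, ← Finset.card_filter] at hs
  have h3 : {v | 3 ≤ A.degree v}.ncard = (Finset.univ.filter fun v => 3 ≤ A.degree v).card := by
    rw [← Set.ncard_coe_finset]; simp
  have h1 : {v | A.degree v = 1}.ncard = (Finset.univ.filter fun v => A.degree v = 1).card := by
    rw [← Set.ncard_coe_finset]; simp
  omega

end Forest

/-! ### Distances in graphs of small independence number -/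

/-- Vertices of a shortest path at even distances from its start are independent, so a connected
graph has diameter at most `2α - 1`. -/
lemma dist_lt_two_mul_indepNum {α : Type*} [Finite α] {A : SimpleGraph α} (hA : A.Connected)
    (u v : α) : A.dist u v < 2 * A.indepNum := by
  classical
  have hex : ∀ i, 2 * i ≤ A.dist u v → ∃ w, A.dist u w = 2 * i := by
    obtain ⟨p, hp⟩ := hA.exists_walk_length_eq_dist u v
    intro i hi
    refine ⟨p.getVert (2 * i), le_antisymm ?_ ?_⟩
    · have := A.dist_le (p.take (2 * i))
      rwa [SimpleGraph.Walk.take_length, min_eq_left (by omega)] at this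
    · have h1 := A.dist_le (p.drop (2 * i))
      rw [SimpleGraph.Walk.drop_length] at h1
      have h2 := hA.dist_triangle (u := u) (v := p.getVert (2 * i)) (w := v)
      omega
  have := hA.nonempty
  choose! f hf using hex
  have hinj : Set.InjOn f (Finset.range (A.dist u v / 2 + 1)) := by
    intro i hi j hj hij
    simp only [Finset.coe_range, mem_Iio] at hi hj
    have h1 := hf i (by omega)
    have h2 := hf j (by omega)
    rw [hij] at h1
    omega
  have hind : A.IsIndepSet ((Finset.range (A.dist u v / 2 + 1)).image f : Finset α) := by
    intro x hx y hy hxy hadj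
    simp only [Finset.coe_image, mem_image, Finset.coe_range, mem_Iio] at hx hy
    obtain ⟨i, hi, rfl⟩ := hx
    obtain ⟨j, hj, rfl⟩ := hy
    have h1 := hf i (by omega)
    have h2 := hf j (by omega)
    have h3 := hadj.diff_dist_adj (u := u)
    have : i ≠ j := fun h => hxy (h ▸ rfl)
    omega
  have hle := hind.card_le_indepNum
  rw [Finset.card_image_of_injOn hinj, Finset.card_range] at hle
  omega

/-! ### Binary paths -/

section BinaryPath

variable {W : Type*} {T : SimpleGraph W} {F : T.Subgraph}

/-- A walk that meets both `S` and its complement has an edge between the two. -/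
lemma exists_boundary_adj {a b : W} (p : T.Walk a b) (S : Set W) :
    ∀ C ∈ p.support, ∀ D ∈ p.support, C ∈ S → D ∉ S →
      ∃ x ∈ p.support, ∃ y ∈ p.support, x ∈ S ∧ y ∉ S ∧ p.toSubgraph.Adj x y := by
  induction p with
  | nil =>
    intro C hC D hD hCS hDS
    simp only [SimpleGraph.Walk.support_nil, List.mem_singleton] at hC hD
    exact absurd (hC ▸ hCS) (hD ▸ hDS)
  | @cons a v b h q ih =>
    intro C hC D hD hCS hDS
    have hle : q.toSubgraph ≤ (SimpleGraph.Walk.cons h q).toSubgraph := le_sup_right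
    have hav : (SimpleGraph.Walk.cons h q).toSubgraph.Adj a v := by simp
    rw [SimpleGraph.Walk.support_cons]
    by_cases ha : a ∈ S <;> by_cases hv : v ∈ S
    · have hDq : D ∈ q.support := by
        rcases List.mem_cons.1 hD with rfl | h
        · exact absurd ha hDS
        · exact h
      obtain ⟨x, hx, y, hy, hxS, hyS, hxy⟩ := ih v q.start_mem_support D hDq hv hDS
      exact ⟨x, List.mem_cons_of_mem _ hx, y, List.mem_cons_of_mem _ hy, hxS, hyS, hle.2 hxy⟩
    · exact ⟨a, List.mem_cons_self, v, List.mem_cons_of_mem _ q.start_mem_support, ha, hv, hav⟩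
    · exact ⟨v, List.mem_cons_of_mem _ q.start_mem_support, a, List.mem_cons_self, hv, ha,
        hav.symm⟩
    · have hCq : C ∈ q.support := by
        rcases List.mem_cons.1 hC with rfl | h
        · exact absurd hCS ha
        · exact h
      obtain ⟨x, hx, y, hy, hxS, hyS, hxy⟩ := ih C hCq v q.start_mem_support hCS hv
      exact ⟨x, List.mem_cons_of_mem _ hx, y, List.mem_cons_of_mem _ hy, hxS, hyS, hle.2 hxy⟩

lemma IsPathBetween.symm {a b : W} {P : Set W} (h : IsPathBetween F a b P) :
    IsPathBetween F b a P := by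
  obtain ⟨p, hp, hF, rfl⟩ := h
  exact ⟨p.reverse, hp.reverse, by rwa [SimpleGraph.Walk.toSubgraph_reverse], by simp⟩

lemma IsPathBetween.subset_verts {a b : W} {P : Set W} (h : IsPathBetween F a b P) :
    P ⊆ F.verts := by
  obtain ⟨p, hp, hF, rfl⟩ := h
  intro C hC
  exact hF.1 ((SimpleGraph.Walk.mem_verts_toSubgraph p).2 hC)

lemma eq_of_deg_le_two [Finite W] {C x y z : W} (h : deg F C ≤ 2) (hx : F.Adj C x)
    (hy : F.Adj C y) (hz : F.Adj C z) (hxy : x ≠ y) (hxz : x ≠ z) : y = z := by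
  by_contra hyz
  have hsub : ({x, y, z} : Set W) ⊆ F.neighborSet C := by
    rintro w (rfl | rfl | rfl) <;> assumption
  have h3 : ({x, y, z} : Set W).ncard = 3 := Set.ncard_eq_three.2 ⟨x, y, z, hxy, hxz, hyz, rfl⟩
  have := Set.ncard_le_ncard hsub
  unfold deg at h
  omega

lemma eq_of_deg_le_one [Finite W] {C x y : W} (h : deg F C ≤ 1) (hx : F.Adj C x)
    (hy : F.Adj C y) : x = y :=
  (Set.ncard_le_one_iff).1 h hx hy

/-- An inner vertex of a path has two neighbours on the path, and no others if its degree is at most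
two. -/
lemma two_le_deg_of_mem_support [Finite W] {a b C : W} {p : T.Walk a b} (hp : p.IsPath)
    (hF : p.toSubgraph ≤ F) (hC : C ∈ p.support) (ha : C ≠ a) (hb : C ≠ b) :
    2 ≤ deg F C ∧ ∀ D, deg F C ≤ 2 → F.Adj C D → D ∈ p.support := by
  obtain ⟨i, rfl, hi⟩ := SimpleGraph.Walk.mem_support_iff_exists_getVert.1 hC
  have hi0 : i ≠ 0 := by rintro rfl; simp at ha
  have hil : i < p.length := by
    refine lt_of_le_of_ne hi ?_
    rintro rfl
    simp at hb
  have hcard := hp.ncard_neighborSet_toSubgraph_internal_eq_two hi0 hil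
  have hsub : p.toSubgraph.neighborSet (p.getVert i) ⊆ F.neighborSet (p.getVert i) :=
    fun _ h => hF.2 h
  refine ⟨hcard ▸ Set.ncard_le_ncard hsub, fun D hdeg hD => ?_⟩
  have heq := Set.eq_of_subset_of_ncard_le hsub (hcard.symm ▸ hdeg)
  have hD' : D ∈ p.toSubgraph.neighborSet (p.getVert i) := heq ▸ hD
  exact SimpleGraph.Walk.mem_support_of_adj_toSubgraph hD'.symm

/-- The end vertex of a nontrivial path has a neighbour on the path. -/
lemma exists_adj_end {a b : W} {p : T.Walk a b} (hF : p.toSubgraph ≤ F) (hab : a ≠ b) {C : W}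
    (hC : C = a ∨ C = b) : ∃ E ∈ p.support, F.Adj C E := by
  have hnil : ¬ p.Nil := fun h => hab h.eq
  rcases hC with rfl | rfl
  · exact ⟨p.snd, p.getVert_mem_support 1, hF.2 (p.toSubgraph_adj_snd hnil)⟩
  · exact ⟨p.penultimate, p.getVert_mem_support _, hF.2 (p.toSubgraph_adj_penultimate hnil).symm⟩

/-- On a binary path with distinct ends, every end has at most one neighbour off the path. -/
lemma outer_unique [Finite W] {a b : W} {p : T.Walk a b} (hp : p.IsPath)
    (hF : p.toSubgraph ≤ F) (hdeg : ∀ C ∈ p.support, deg F C ≤ 2) (hab : a ≠ b) {C D D' : W}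
    (hC : C ∈ p.support) (hD : D ∉ p.support) (hD' : D' ∉ p.support) (h : F.Adj C D)
    (h' : F.Adj C D') : D = D' := by
  have hCab : C = a ∨ C = b := by
    by_contra hcon
    push Not at hcon
    exact hD ((two_le_deg_of_mem_support hp hF hC hcon.1 hcon.2).2 D (hdeg C hC) h)
  obtain ⟨E, hE, hCE⟩ := exists_adj_end hF hab hCab
  exact eq_of_deg_le_two (hdeg C hC) hCE h h' (fun e => hD (e ▸ hE)) (fun e => hD' (e ▸ hE))

namespace IsMaximalBinaryPath

variable {P Q : Set W}

lemma exists_walk (h : IsMaximalBinaryPath F P) :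
    ∃ (a b : W) (p : T.Walk a b), p.IsPath ∧ p.toSubgraph ≤ F ∧ P = {C | C ∈ p.support} := by
  obtain ⟨⟨⟨a, b, p, hp, hF, hP⟩, -⟩, -⟩ := h
  exact ⟨a, b, p, hp, hF, hP⟩

lemma subset_verts (h : IsMaximalBinaryPath F P) : P ⊆ F.verts := by
  obtain ⟨⟨⟨a, b, hab⟩, -⟩, -⟩ := h
  exact hab.subset_verts

lemma nonempty (h : IsMaximalBinaryPath F P) : P.Nonempty := by
  obtain ⟨a, b, p, -, -, rfl⟩ := h.exists_walk
  exact ⟨a, p.start_mem_support⟩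

lemma deg_le_two (h : IsMaximalBinaryPath F P) {C : W} (hC : C ∈ P) : deg F C ≤ 2 :=
  h.1.2 C hC

lemma eq_end_of_adj [Finite W] (h : IsMaximalBinaryPath F P) {a b : W} {p : T.Walk a b}
    (hp : p.IsPath) (hF : p.toSubgraph ≤ F) (hP : P = {C | C ∈ p.support}) {C D : W} (hC : C ∈ P)
    (hD : D ∉ P) (hCD : F.Adj C D) : C = a ∨ C = b := by
  subst hP
  by_contra hcon
  push Not at hcon
  exact hD ((two_le_deg_of_mem_support hp hF hC hcon.1 hcon.2).2 D (h.deg_le_two hC) hCD)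

/-- A neighbour off a maximal binary path is a branch vertex, as the path could be extended by it
otherwise. -/
lemma three_le_deg [Finite W] (h : IsMaximalBinaryPath F P) {C D : W} (hC : C ∈ P) (hD : D ∉ P)
    (hCD : F.Adj C D) : 3 ≤ deg F D := by
  by_contra hlt
  obtain ⟨⟨a, b, hab⟩, hdeg⟩ := h.1
  have key : ∀ a b, IsPathBetween F a b P → C = b → False := by
    rintro a b ⟨p, hp, hF, hP⟩ rfl
    have hDp : D ∉ p.support := fun hmem => hD (hP ▸ hmem)
    have hbin : IsBinaryPath F (insert D P) := by
      refine ⟨⟨a, D, p.concat hCD.adj_sub, hp.concat hDp _, ?_, ?_⟩, ?_⟩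
      · rw [SimpleGraph.Walk.concat_eq_append, SimpleGraph.Walk.toSubgraph_append]
        refine sup_le hF ?_
        rw [SimpleGraph.Walk.toSubgraph_cons_nil_eq_subgraphOfAdj]
        exact SimpleGraph.subgraphOfAdj_le_of_adj F hCD
      · ext E
        simp [SimpleGraph.Walk.support_concat, hP, or_comm]
      · rintro E (rfl | hE)
        · omega
        · exact hdeg E hE
    exact hD (h.2 hbin (subset_insert _ _) (mem_insert _ _))
  have hab' := hab
  obtain ⟨p, hp, hF, hP⟩ := hab'
  rcases h.eq_end_of_adj hp hF hP hC hD hCD with rfl | rfl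
  · exact key b _ hab.symm rfl
  · exact key a _ hab rfl

lemma subset_of_mem [Finite W] (hP : IsMaximalBinaryPath F P) (hQ : IsMaximalBinaryPath F Q)
    {C : W} (hCP : C ∈ P) (hCQ : C ∈ Q) : Q ⊆ P := by
  intro D hD
  by_contra hDP
  obtain ⟨a, b, p, hp, hF, rfl⟩ := hQ.exists_walk
  obtain ⟨x, hx, y, hy, hxP, hyP, hxy⟩ := exists_boundary_adj p P C hCQ D hD hCP hDP
  have h3 := hP.three_le_deg hxP hyP (hF.2 hxy)
  have h2 := hQ.deg_le_two hy
  omega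

lemma eq_of_mem [Finite W] (hP : IsMaximalBinaryPath F P) (hQ : IsMaximalBinaryPath F Q)
    {C : W} (hCP : C ∈ P) (hCQ : C ∈ Q) : P = Q :=
  (hQ.subset_of_mem hP hCQ hCP).antisymm (hP.subset_of_mem hQ hCP hCQ)

lemma exists_mem [Finite W] {C : W} (hC : C ∈ F.verts) (hdeg : deg F C ≤ 2) :
    ∃ P, IsMaximalBinaryPath F P ∧ C ∈ P := by
  have h0 : IsBinaryPath F {C} := by
    refine ⟨⟨C, C, .nil, .nil, ?_, by simp⟩, ?_⟩
    · simpa using hC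
    · rintro D rfl
      exact hdeg
  obtain ⟨P, hle, hP⟩ := (Set.toFinite {P | IsBinaryPath F P}).exists_le_maximal h0
  exact ⟨P, hP, hle rfl⟩

/-- A maximal binary path that is not pendant is internal. -/
lemma deg_eq_two [Finite W] (h : IsMaximalBinaryPath F P) (hpen : ¬ IsMaximalPendantPath F P)
    {C : W} (hC : C ∈ P) : deg F C = 2 := by
  have hle := h.deg_le_two hC
  obtain ⟨⟨a, b, hab⟩, -⟩ := h.1
  have key : ∀ a b, IsPathBetween F a b P → C = a → deg F C = 2 := by
    rintro a b hab rfl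
    have h1 : deg F C ≠ 1 := fun h1 => hpen ⟨h, Or.inl ⟨C, b, hab, Or.inl h1⟩⟩
    have h0 : deg F C ≠ 0 := by
      intro h0
      obtain ⟨p, hp, hF, hP⟩ := hab
      by_cases hCb : C = b
      · subst hCb
        refine hpen ⟨h, Or.inr ⟨C, ?_, h0⟩⟩
        rw [hP, SimpleGraph.Walk.isPath_iff_nil.1 hp |>.eq_nil]
        simp
      · obtain ⟨E, -, hE⟩ := exists_adj_end hF hCb (Or.inl rfl)
        have : (F.neighborSet C).ncard ≠ 0 := Set.ncard_ne_zero_of_mem hE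
        exact this h0
    omega
  have hab' := hab
  obtain ⟨p, hp, hF, hP⟩ := hab'
  by_cases ha : C = a
  · exact key a b hab ha
  by_cases hb : C = b
  · exact key b a hab.symm hb
  have := (two_le_deg_of_mem_support hp hF (hP ▸ hC : C ∈ {C | C ∈ p.support}) ha hb).1
  omega

end IsMaximalBinaryPath

/-- A maximal pendant path is joined to the rest of the forest by at most one edge, which leaves it
at an end vertex. -/
lemma IsMaximalPendantPath.exists_walk [Finite W] {P : Set W} (h : IsMaximalPendantPath F P) :
    ∃ (a b : W) (p : T.Walk a b), p.IsPath ∧ p.toSubgraph ≤ F ∧ P = {C | C ∈ p.support} ∧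
      ∀ C ∈ P, ∀ D ∉ P, F.Adj C D → C = b ∧ ∀ C' ∈ P, ∀ D' ∉ P, F.Adj C' D' → D' = D := by
  obtain ⟨hmax, hend⟩ := h
  have key : ∀ a b, IsPathBetween F a b P → deg F a ≤ 1 → ∃ (p : T.Walk a b), p.IsPath ∧
      p.toSubgraph ≤ F ∧ P = {C | C ∈ p.support} ∧ ∀ C ∈ P, ∀ D ∉ P, F.Adj C D → C = b ∧
        ∀ C' ∈ P, ∀ D' ∉ P, F.Adj C' D' → D' = D := by
    rintro a b ⟨p, hp, hF, hP⟩ ha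
    have hend' : ∀ C ∈ P, ∀ D ∉ P, F.Adj C D → C = b := by
      intro C hC D hD hCD
      rcases hmax.eq_end_of_adj hp hF hP hC hD hCD with rfl | rfl
      · by_contra hCb
        obtain ⟨E, hE, hCE⟩ := exists_adj_end hF hCb (Or.inl rfl)
        exact hD (eq_of_deg_le_one ha hCE hCD ▸ (hP ▸ hE : E ∈ P))
      · rfl
    refine ⟨p, hp, hF, hP, fun C hC D hD hCD => ⟨hend' C hC D hD hCD, fun C' hC' D' hD' hCD' => ?_⟩⟩
    obtain rfl := hend' C hC D hD hCD
    obtain rfl := hend' C' hC' D' hD' hCD'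
    by_cases hab : a = C'
    · subst hab
      exact eq_of_deg_le_one ha hCD' hCD
    · subst hP
      exact outer_unique hp hF (fun C hC => hmax.deg_le_two hC) hab hC hD' hD hCD' hCD
  rcases hend with ⟨a, b, hab, ha | hb⟩ | ⟨a, rfl, ha⟩
  · exact ⟨a, b, key a b hab ha.le⟩
  · exact ⟨b, a, key b a hab.symm hb.le⟩
  · refine ⟨a, a, key a a ⟨.nil, .nil, ?_, by simp⟩ (by omega)⟩
    simpa using hmax.subset_verts (mem_singleton a)

end BinaryPath

/-! ### Clique forests -/

section CliqueForest

variable {V : Type*} {G : SimpleGraph V} {T : SimpleGraph (MaxClique G)}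

lemma exists_maxClique [Finite V] {S : Set V} (hS : G.IsClique S) :
    ∃ C : MaxClique G, S ⊆ C.1 := by
  obtain ⟨C, hle, hC⟩ := (Set.toFinite {S : Set V | G.IsClique S}).exists_le_maximal hS
  exact ⟨⟨C, hC⟩, hle⟩

lemma isClique_maxClique (C : MaxClique G) : G.IsClique C.1 := C.2.1

lemma IsCliqueForest.exists_isPath (hT : IsCliqueForest G T) {C D : MaxClique G} {v : V}
    (hC : v ∈ C.1) (hD : v ∈ D.1) : ∃ p : T.Walk C D, p.IsPath ∧ ∀ E ∈ p.support, v ∈ E.1 := by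
  obtain ⟨q, hq⟩ := ((hT.2 v).connected ⟨C, hC⟩ ⟨D, hD⟩).exists_isPath
  let f := SimpleGraph.Embedding.induce (G := T) {C : MaxClique G | v ∈ C.1}
  refine ⟨q.map f.toHom, hq.map f.injective, fun E hE => ?_⟩
  have hE' : E ∈ q.support.map f :=
    (congrArg (E ∈ ·) (SimpleGraph.Walk.support_map f.toHom q)).mp hE
  obtain ⟨E', -, rfl⟩ := List.mem_map.1 hE'
  exact E'.2

/-- The trees of nodes in a clique forest are convex. -/
lemma IsCliqueForest.mem_of_mem_support (hT : IsCliqueForest G T) {C D E : MaxClique G}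
    {p : T.Walk C D} (hp : p.IsPath) {v : V} (hC : v ∈ C.1) (hD : v ∈ D.1)
    (hE : E ∈ p.support) : v ∈ E.1 := by
  obtain ⟨q, hq, hv⟩ := hT.exists_isPath hC hD
  obtain rfl : p = q :=
    congrArg Subtype.val ((hT.1.subsingleton_path C D).elim ⟨p, hp⟩ ⟨q, hq⟩)
  exact hv E hE

/-- The positions on the path `p` of the cliques that contain `v`. -/
def positions {a b : MaxClique G} (p : T.Walk a b) (v : V) : Set ℕ :=
  {i | i ≤ p.length ∧ v ∈ (p.getVert i).1}

lemma IsCliqueForest.ordConnected_positions (hT : IsCliqueForest G T) {a b : MaxClique G}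
    {p : T.Walk a b} (hp : p.IsPath) (v : V) : (positions p v).OrdConnected := by
  refine ⟨fun i hi j hj l hl => ⟨hl.2.trans hj.1, ?_⟩⟩
  have hq : ((p.drop i).take (j - i)).IsPath := (hp.drop i).take _
  have hij : i + (j - i) = j := by have := hl.1.trans hl.2; omega
  refine hT.mem_of_mem_support hq hi.2 ?_ ?_
  · rw [SimpleGraph.Walk.drop_getVert, hij]
    exact hj.2
  · have h2 := hl.1
    have h3 := hl.2
    have h : p.getVert l = ((p.drop i).take (j - i)).getVert (l - i) := by
      rw [SimpleGraph.Walk.take_getVert, SimpleGraph.Walk.drop_getVert]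
      congr 1
      omega
    rw [h]
    exact SimpleGraph.Walk.getVert_mem_support _ _

/-- The graph on the nodes of `U` in which two nodes are joined if they share a clique of `P`. -/
def sharedGraph (G : SimpleGraph V) (U : Set V) (P : Set (MaxClique G)) : SimpleGraph V where
  Adj u v := u ≠ v ∧ u ∈ U ∧ v ∈ U ∧ ∃ C ∈ P, u ∈ C.1 ∧ v ∈ C.1
  symm := ⟨fun _ _ ⟨h, hu, hv, C, hC, huC, hvC⟩ => ⟨h.symm, hv, hu, C, hC, hvC, huC⟩⟩
  loopless := ⟨fun _ h => h.1 rfl⟩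

lemma adj_induce_of_mem {U : Set V} {u v : V} (hu : u ∈ U) (hv : v ∈ U) (huv : u ≠ v)
    {C : MaxClique G} (huC : u ∈ C.1) (hvC : v ∈ C.1) : (G.induce U).spanningCoe.Adj u v := by
  rw [SimpleGraph.map_adj]
  exact ⟨⟨u, hu⟩, ⟨v, hv⟩, isClique_maxClique C huC hvC huv, rfl, rfl⟩

lemma sharedGraph_le (U : Set V) (P : Set (MaxClique G)) :
    sharedGraph G U P ≤ (G.induce U).spanningCoe := by
  rintro u v ⟨huv, hu, hv, C, -, huC, hvC⟩
  exact adj_induce_of_mem hu hv huv huC hvC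

/-- A walk in the shared graph of a path `P` from the first to the last clique of `P` meets every
clique of `P`: the trees of its nodes cover `P`. -/
lemma IsCliqueForest.exists_mem_support (hT : IsCliqueForest G T) {U : Set V} {a b : MaxClique G}
    {p : T.Walk a b} (hp : p.IsPath) {x y : V}
    (w : (sharedGraph G U {C | C ∈ p.support}).Walk x y) (hx : x ∈ a.1) (hy : y ∈ b.1)
    {C : MaxClique G} (hC : C ∈ p.support) : ∃ z ∈ w.support, z ∈ C.1 := by
  obtain ⟨t, rfl, ht⟩ := SimpleGraph.Walk.mem_support_iff_exists_getVert.1 hC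
  by_contra hcon
  push Not at hcon
  -- Otherwise the trees of all nodes of the walk stay on the side of `a`.
  have key : ∀ {x y : V} (w : (sharedGraph G U {C | C ∈ p.support}).Walk x y),
      (∀ z ∈ w.support, z ∉ (p.getVert t).1) → (∃ i ∈ positions p x, i < t) →
      ∃ i ∈ positions p y, i < t := by
    intro x y w
    induction w with
    | nil => exact fun _ h => h
    | @cons x v y h q ih =>
      rintro hout ⟨i, hi, hit⟩
      have hxt := hout x (SimpleGraph.Walk.start_mem_support _)
      have hqt := fun z hz => hout z (List.mem_cons_of_mem _ hz)
      obtain ⟨-, -, -, D, hD, hxD, hvD⟩ := h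
      obtain ⟨j, rfl, hj⟩ := SimpleGraph.Walk.mem_support_iff_exists_getVert.1 hD
      refine ih hqt ⟨j, ⟨hj, hvD⟩, ?_⟩
      by_contra hjt
      exact hxt
        ((hT.ordConnected_positions hp x).out hi ⟨hj, hxD⟩ ⟨hit.le, not_lt.1 hjt⟩).2
  have ht0 : 0 < t := by
    rcases Nat.eq_zero_or_pos t with rfl | h
    · exact absurd (by simpa using hx) (hcon x w.start_mem_support)
    · exact h
  obtain ⟨i, hi, hit⟩ := key w hcon ⟨0, ⟨by omega, by simpa using hx⟩, ht0⟩
  exact hcon y w.end_mem_support ((hT.ordConnected_positions hp y).out hi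
    (⟨le_rfl, by simpa using hy⟩ : p.length ∈ positions p y) ⟨hit.le, ht⟩).2

lemma edist_le_length_of_mem_support {α : Type*} {A : SimpleGraph α} {x y u v : α}
    (w : A.Walk x y) (hu : u ∈ w.support) (hv : v ∈ w.support) : A.edist u v ≤ w.length := by
  obtain ⟨i, rfl, hi⟩ := SimpleGraph.Walk.mem_support_iff_exists_getVert.1 hu
  obtain ⟨j, rfl, hj⟩ := SimpleGraph.Walk.mem_support_iff_exists_getVert.1 hv
  have key : ∀ i j, i ≤ j → A.edist (w.getVert i) (w.getVert j) ≤ w.length := by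
    intro i j hij
    have h : A.edist (w.getVert i) ((w.drop i).getVert (j - i)) ≤ w.length := by
      refine ((w.drop i).take (j - i)).edist_le.trans ?_
      rw [SimpleGraph.Walk.take_length, SimpleGraph.Walk.drop_length]
      exact_mod_cast (by omega : min (j - i) (w.length - i) ≤ w.length)
    rwa [SimpleGraph.Walk.drop_getVert, show i + (j - i) = j by omega] at h
  rcases le_total i j with h | h
  · exact key i j h
  · rw [SimpleGraph.edist_comm]
    exact key j i h

/-- A short walk in the shared graph between the two ends of a path bounds its diameter. -/
lemma IsCliqueForest.pathDiam_le (hT : IsCliqueForest G T) {U : Set V} {a b : MaxClique G}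
    {p : T.Walk a b} (hp : p.IsPath) {P : Set (MaxClique G)} (hP : P = {C | C ∈ p.support})
    (hU : nodesOf P ⊆ U) {x y : V} (w : (sharedGraph G U P).Walk x y) (hx : x ∈ a.1)
    (hy : y ∈ b.1) : pathDiam G U P ≤ (w.length + 2 : ℕ) := by
  subst hP
  have near : ∀ u ∈ nodesOf {C | C ∈ p.support}, ∃ z ∈ w.support, distIn G U u z ≤ 1 := by
    intro u hu
    obtain ⟨C, hC, huC⟩ := id hu
    obtain ⟨z, hz, hzC⟩ := hT.exists_mem_support hp w hx hy hC
    refine ⟨z, hz, SimpleGraph.edist_le_one_iff_adj_or_eq.2 ?_⟩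
    by_cases huz : u = z
    · exact Or.inr huz
    · exact Or.inl (adj_induce_of_mem (hU hu) (hU ⟨C, hC, hzC⟩) huz huC hzC)
  refine iSup₂_le fun u hu => iSup₂_le fun v hv => ?_
  obtain ⟨z, hz, huz⟩ := near u hu
  obtain ⟨z', hz', hvz'⟩ := near v hv
  have hzz' : distIn G U z z' ≤ w.length := by
    have := edist_le_length_of_mem_support (w.mapLe (sharedGraph_le U _)) (u := z) (v := z')
      (by simpa using hz) (by simpa using hz')
    simpa [distIn] using this
  have h1 : distIn G U u v ≤ distIn G U u z + distIn G U z v := SimpleGraph.edist_triangle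
  have h2 : distIn G U z v ≤ distIn G U z z' + distIn G U z' v := SimpleGraph.edist_triangle
  have h3 : distIn G U z' v ≤ 1 := by
    unfold distIn at hvz' ⊢
    rwa [SimpleGraph.edist_comm]
  calc distIn G U u v ≤ 1 + (w.length + 1) :=
        h1.trans (add_le_add huz (h2.trans (add_le_add hzz' h3)))
    _ = (w.length + 2 : ℕ) := by push_cast; ring

/-- A leaf of a clique forest contains a node that lies in no other clique. -/
lemma IsCliqueForest.exists_private_node (hT : IsCliqueForest G T) {C D : MaxClique G}
    (hCD : T.Adj C D) (hleaf : ∀ D', T.Adj C D' → D' = D) :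
    ∃ v ∈ C.1, ∀ E : MaxClique G, v ∈ E.1 → E = C := by
  have hne : ¬ C.1 ⊆ D.1 := fun hsub => hCD.ne (Subtype.ext (C.2.eq_of_subset D.2.1 hsub))
  obtain ⟨v, hvC, hvD⟩ := Set.not_subset.1 hne
  refine ⟨v, hvC, fun E hvE => ?_⟩
  obtain ⟨p, hp, -⟩ := hT.exists_isPath hvC hvE
  cases p with
  | nil => rfl
  | @cons _ D' _ h q =>
    obtain rfl := hleaf D' h
    exact absurd (hT.mem_of_mem_support hp hvC hvE (by simp)) hvD

/-- The number of leaves of a clique forest is at most the independence number. -/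
lemma IsCliqueForest.ncard_leaves_le [Finite V] (hT : IsCliqueForest G T) :
    {C | (T.neighborSet C).ncard = 1}.ncard ≤ G.indepNum := by
  have hex : ∀ C ∈ {C | (T.neighborSet C).ncard = 1}, ∃ v ∈ C.1,
      ∀ E : MaxClique G, v ∈ E.1 → E = C := by
    intro C hC
    obtain ⟨D, hD⟩ := Set.ncard_eq_one.1 hC
    refine hT.exists_private_node (D := D) ?_ fun D' hD' => ?_
    · exact (hD ▸ mem_singleton D : D ∈ T.neighborSet C)
    · exact (hD ▸ hD' : D' ∈ ({D} : Set (MaxClique G)))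
  rcases {C | (T.neighborSet C).ncard = 1}.eq_empty_or_nonempty with h0 | ⟨C₀, hC₀⟩
  · rw [h0, Set.ncard_empty]
    exact Nat.zero_le _
  have : Nonempty V := ⟨(hex C₀ hC₀).choose⟩
  choose! f hfC hf using hex
  have hinj : Set.InjOn f {C | (T.neighborSet C).ncard = 1} := fun C hC D hD h =>
    hf D hD C (by rw [← h]; exact hfC C hC)
  rw [← hinj.ncard_image, ← alpha_univ]
  refine ncard_le_alpha (subset_univ _) ?_
  rintro _ ⟨C, hC, rfl⟩ _ ⟨D, hD, rfl⟩ hne hadj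
  obtain ⟨E, hE⟩ := exists_maxClique (G := G) (S := {f C, f D})
    (by rw [SimpleGraph.isClique_pair]; exact fun _ => hadj)
  have h1 := hf C hC E (hE (by simp))
  have h2 := hf D hD E (hE (by simp))
  exact hne (by rw [← h1, ← h2])

end CliqueForest

/-! ### Invariants of the algorithm -/

section Invariants

variable {V : Type*} {G : SimpleGraph V} {T : SimpleGraph (MaxClique G)}

lemma dParam_pos {ε : ℝ} (hε : 0 < ε) : 0 < dParam ε :=
  Nat.ceil_pos.2 (by positivity)

/-- The invariants of the state as long as the forest is updated: the forest `F` is induced in `T`,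
the remaining nodes are those of the remaining cliques, the remaining cliques that contain a given
node form a subtree of `T`, and remaining nodes that are adjacent share a remaining clique. -/
structure IsRegular (s : State G T) : Prop where
  adj_of_adj : ∀ C ∈ s.F.verts, ∀ D ∈ s.F.verts, T.Adj C D → s.F.Adj C D
  mem_U_iff : ∀ v, v ∈ s.U ↔ ∃ C ∈ s.F.verts, v ∈ C.1
  mem_verts : ∀ v : V, ∀ C ∈ s.F.verts, ∀ D ∈ s.F.verts, v ∈ C.1 → v ∈ D.1 →
    ∀ p : T.Walk C D, p.IsPath → ∀ E ∈ p.support, E ∈ s.F.verts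
  exists_common : ∀ u ∈ s.U, ∀ v ∈ s.U, G.Adj u v → ∃ C ∈ s.F.verts, u ∈ C.1 ∧ v ∈ C.1

lemma isRegular_initState [Finite V] : IsRegular (initState G T) where
  adj_of_adj _ _ _ _ h := h
  mem_U_iff v := by
    obtain ⟨C, hC⟩ := exists_maxClique (G := G) (S := {v}) (by simp)
    exact ⟨fun _ => ⟨C, trivial, hC rfl⟩, fun _ => trivial⟩
  mem_verts _ _ _ _ _ _ _ _ _ _ _ := trivial
  exists_common u _ v _ h := by
    obtain ⟨C, hC⟩ := exists_maxClique (G := G) (S := {u, v})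
      (by rw [SimpleGraph.isClique_pair]; exact fun _ => h)
    exact ⟨C, trivial, hC (by simp), hC (by simp)⟩

variable {s : State G T} {ε : ℝ} {i : ℕ} {P Q : Set (MaxClique G)}

lemma isMaximalBinaryPath_of_mem_layer (hP : P ∈ layer ε i s) : IsMaximalBinaryPath s.F P := by
  rcases hP with h | h
  · exact h.1
  · exact h.1.1

lemma notMem_layer_of_three_le_deg {C : MaxClique G} (hC : 3 ≤ deg s.F C) :
    C ∉ ⋃₀ layer ε i s := by
  rintro ⟨P, hP, hCP⟩
  have := (isMaximalBinaryPath_of_mem_layer hP).deg_le_two hCP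
  omega

namespace IsRegular

lemma mem_U (hs : IsRegular s) {C : MaxClique G} (hC : C ∈ s.F.verts) {v : V} (hv : v ∈ C.1) :
    v ∈ s.U :=
  (hs.mem_U_iff v).2 ⟨C, hC, hv⟩

/-- A node with remaining cliques inside and outside `S` lies in both ends of an edge that
leaves `S`. -/
lemma exists_exit (hs : IsRegular s) (hT : IsCliqueForest G T) {S : Set (MaxClique G)}
    {C D : MaxClique G} (hC : C ∈ s.F.verts) (hD : D ∈ s.F.verts) {v : V} (hvC : v ∈ C.1)
    (hvD : v ∈ D.1) (hCS : C ∈ S) (hDS : D ∉ S) :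
    ∃ A ∈ S, ∃ B ∉ S, s.F.Adj A B ∧ v ∈ A.1 ∧ v ∈ B.1 := by
  obtain ⟨p, hp, hv⟩ := hT.exists_isPath hvC hvD
  have hsub := hs.mem_verts v C hC D hD hvC hvD p hp
  obtain ⟨A, hA, B, hB, hAS, hBS, hAB⟩ :=
    exists_boundary_adj p S C p.start_mem_support D p.end_mem_support hCS hDS
  exact ⟨A, hAS, B, hBS, hs.adj_of_adj A (hsub A hA) B (hsub B hB) hAB.adj_sub, hv A hA, hv B hB⟩

lemma exists_exit_of_notMem_pathNodes (hs : IsRegular s) (hT : IsCliqueForest G T)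
    (hP : P ⊆ s.F.verts) {C : MaxClique G} (hC : C ∈ P) {v : V} (hv : v ∈ C.1)
    (hvP : v ∉ pathNodes s P) : ∃ A ∈ P, ∃ B ∉ P, s.F.Adj A B ∧ v ∈ A.1 ∧ v ∈ B.1 := by
  have : ∃ D ∈ s.F.verts, v ∈ D.1 ∧ D ∉ P := by
    by_contra hcon
    push Not at hcon
    exact hvP ⟨hs.mem_U (hP hC) hv, hcon⟩
  obtain ⟨D, hD, hvD, hDP⟩ := this
  exact hs.exists_exit hT (hP hC) hD hv hvD hC hDP

lemma nodesOf_subset (hs : IsRegular s) (hP : P ⊆ s.F.verts) : nodesOf P ⊆ s.U := by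
  rintro v ⟨C, hC, hv⟩
  exact hs.mem_U (hP hC) hv

/-- A node of `W_P` and a remaining neighbour share a clique of `P`. -/
lemma exists_common_path (hs : IsRegular s) {u v : V} (hu : u ∈ pathNodes s P) (hv : v ∈ s.U)
    (huv : G.Adj u v) : ∃ C ∈ P, u ∈ C.1 ∧ v ∈ C.1 := by
  obtain ⟨C, hC, huC, hvC⟩ := hs.exists_common u hu.1 v hv huv
  exact ⟨C, hu.2 C hC huC, huC, hvC⟩

lemma exists_mem_of_mem_pathNodes (hs : IsRegular s) {u : V} (hu : u ∈ pathNodes s P) :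
    ∃ C ∈ P, u ∈ C.1 := by
  obtain ⟨C, hC, huC⟩ := (hs.mem_U_iff u).1 hu.1
  exact ⟨C, hu.2 C hC huC, huC⟩

/-- Two nodes that share a clique of a peeled path and leave the path do so by the same edge:
otherwise they would dominate the path, which would then have diameter at most three. -/
lemma exit_unique [Finite V] (hs : IsRegular s) (hT : IsCliqueForest G T) (hε : 0 < ε)
    (hi : i < kParam ε) (hP : P ∈ layer ε i s) {A B A' B' E : MaxClique G} {u v : V} (hA : A ∈ P)
    (hB : B ∉ P) (hAB : s.F.Adj A B) (hA' : A' ∈ P) (hB' : B' ∉ P) (hAB' : s.F.Adj A' B')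
    (huA : u ∈ A.1) (hvA : v ∈ A'.1) (hE : E ∈ P) (huE : u ∈ E.1) (hvE : v ∈ E.1) : B = B' := by
  have hmax := isMaximalBinaryPath_of_mem_layer hP
  rcases hP with hpen | ⟨-, ⟨-, hdiam⟩ | ⟨hik, -⟩⟩
  · obtain ⟨a, b, p, hp, hF, hPp, hexit⟩ := hpen.exists_walk
    exact (hexit A' hA' B' hB' hAB').2 A hA B hB hAB
  · by_contra hne
    obtain ⟨a, b, p, hp, hF, hPp⟩ := hmax.exists_walk
    have hsub := hs.nodesOf_subset hmax.subset_verts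
    -- By the diameter bound, a walk between the two end cliques has at least two edges.
    have hshort : ∀ {x y : V} (w : (sharedGraph G s.U P).Walk x y), x ∈ a.1 → y ∈ b.1 →
        2 ≤ w.length := by
      intro x y w hx hy
      have h := hdiam.trans (hT.pathDiam_le hp hPp hsub w hx hy)
      rw [Nat.cast_le] at h
      have := dParam_pos hε
      omega
    have hw : ∀ x y : V, x ∈ E.1 → y ∈ E.1 →
        ∃ w : (sharedGraph G s.U P).Walk x y, w.length ≤ 1 := by
      intro x y hx hy
      by_cases hxy : x = y
      · subst hxy
        exact ⟨.nil, by simp⟩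
      · have hadj : (sharedGraph G s.U P).Adj x y :=
          ⟨hxy, hsub ⟨E, hE, hx⟩, hsub ⟨E, hE, hy⟩, E, hE, hx, hy⟩
        exact ⟨hadj.toWalk, by simp⟩
    have hfalse : ∀ x y : V, x ∈ E.1 → y ∈ E.1 → x ∈ a.1 → y ∈ b.1 → False := by
      intro x y hx hy hxa hyb
      obtain ⟨w, hw⟩ := hw x y hx hy
      have := hshort w hxa hyb
      omega
    by_cases hAA' : A = A'
    · subst hAA'
      by_cases hab : a = b
      · subst hab
        rcases hmax.eq_end_of_adj hp hF hPp hA hB hAB with rfl | rfl <;>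
          exact hfalse u u huE huE huA huA
      · subst hPp
        exact hne (outer_unique hp hF (fun C hC => hmax.deg_le_two hC) hab hA hB hB' hAB hAB')
    · rcases hmax.eq_end_of_adj hp hF hPp hA hB hAB with rfl | rfl <;>
        rcases hmax.eq_end_of_adj hp hF hPp hA' hB' hAB' with rfl | rfl
      · exact hAA' rfl
      · exact hfalse u v huE hvE huA hvA
      · exact hfalse v u hvE huE hvA huA
      · exact hAA' rfl
  · omega

end IsRegular

variable {c : Set (MaxClique G) → Set V → Set V}

lemma nextState_F (hi : i < kParam ε) :
    (nextState ε i s c).F = s.F.deleteVerts (⋃₀ layer ε i s) := by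
  simp [nextState, hi]

lemma mem_verts_nextState (hi : i < kParam ε) {C : MaxClique G} :
    C ∈ (nextState ε i s c).F.verts ↔ C ∈ s.F.verts ∧ C ∉ ⋃₀ layer ε i s := by
  rw [nextState_F hi, SimpleGraph.Subgraph.deleteVerts_verts]
  exact Iff.rfl

lemma mem_U_nextState {v : V} :
    v ∈ (nextState ε i s c).U ↔ v ∈ s.U ∧ ∀ P ∈ layer ε i s, v ∉ pathNodes s P := by
  simp [nextState]

/-- The vertex reached by an edge that leaves a peeled path is not peeled. -/
lemma notMem_layer_of_exit [Finite V] (hP : P ∈ layer ε i s) {A B : MaxClique G} (hA : A ∈ P)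
    (hB : B ∉ P) (hAB : s.F.Adj A B) : B ∉ ⋃₀ layer ε i s :=
  notMem_layer_of_three_le_deg ((isMaximalBinaryPath_of_mem_layer hP).three_le_deg hA hB hAB)

lemma IsRegular.isRegular_nextState [Finite V] (hs : IsRegular s) (hT : IsCliqueForest G T)
    (hε : 0 < ε) (hi : i < kParam ε) : IsRegular (nextState ε i s c) where
  adj_of_adj C hC D hD h := by
    rw [mem_verts_nextState hi] at hC hD
    rw [nextState_F hi, SimpleGraph.Subgraph.deleteVerts_adj]
    exact ⟨hC.1, hC.2, hD.1, hD.2, hs.adj_of_adj C hC.1 D hD.1 h⟩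
  mem_U_iff v := by
    simp only [mem_U_nextState, mem_verts_nextState hi]
    constructor
    · rintro ⟨hv, hout⟩
      obtain ⟨C, hC, hvC⟩ := (hs.mem_U_iff v).1 hv
      by_cases hCl : C ∈ ⋃₀ layer ε i s
      · obtain ⟨P, hP, hCP⟩ := hCl
        obtain ⟨A, hA, B, hB, hAB, -, hvB⟩ := hs.exists_exit_of_notMem_pathNodes hT
          (isMaximalBinaryPath_of_mem_layer hP).subset_verts hCP hvC (hout P hP)
        exact ⟨B, ⟨hAB.snd_mem, notMem_layer_of_exit hP hA hB hAB⟩, hvB⟩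
      · exact ⟨C, ⟨hC, hCl⟩, hvC⟩
    · rintro ⟨C, ⟨hC, hCl⟩, hvC⟩
      exact ⟨hs.mem_U hC hvC, fun P hP hvP => hCl ⟨P, hP, hvP.2 C hC hvC⟩⟩
  mem_verts v C hC D hD hvC hvD p hp E hE := by
    rw [mem_verts_nextState hi] at hC hD ⊢
    have hv := fun E (hE : E ∈ p.support) => hT.mem_of_mem_support hp hvC hvD hE
    have hsub := hs.mem_verts v C hC.1 D hD.1 hvC hvD p hp
    refine ⟨hsub E hE, ?_⟩
    rintro ⟨P, hP, hEP⟩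
    obtain ⟨q, r, hq, hr, rfl⟩ := hp.mem_support_iff_exists_append.1 hE
    have hqs : ∀ {X}, X ∈ q.support → X ∈ (q.append r).support := fun h =>
      (SimpleGraph.Walk.mem_support_append_iff _ _).2 (Or.inl h)
    have hrs : ∀ {X}, X ∈ r.support → X ∈ (q.append r).support := fun h =>
      (SimpleGraph.Walk.mem_support_append_iff _ _).2 (Or.inr h)
    obtain ⟨A, hA, B, hB, hAP, hBP, hAB⟩ := exists_boundary_adj q P E q.end_mem_support C
      q.start_mem_support hEP (fun h => hC.2 ⟨P, hP, h⟩)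
    obtain ⟨A', hA', B', hB', hAP', hBP', hAB'⟩ := exists_boundary_adj r P E r.start_mem_support D
      r.end_mem_support hEP (fun h => hD.2 ⟨P, hP, h⟩)
    have heq : B = B' := hs.exit_unique hT hε hi hP hAP hBP
      (hs.adj_of_adj A (hsub A (hqs hA)) B (hsub B (hqs hB)) hAB.adj_sub) hAP' hBP'
      (hs.adj_of_adj A' (hsub A' (hrs hA')) B' (hsub B' (hrs hB')) hAB'.adj_sub)
      (hv A (hqs hA)) (hv A' (hrs hA')) hEP (hv E hE) (hv E hE)
    exact hp.ne_of_mem_support_of_append (fun h => hBP' (by rwa [h])) hB hB' heq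
  exists_common u hu v hv huv := by
    rw [mem_U_nextState] at hu hv
    obtain ⟨E, hE, huE, hvE⟩ := hs.exists_common u hu.1 v hv.1 huv
    by_cases hEl : E ∈ ⋃₀ layer ε i s
    · obtain ⟨P, hP, hEP⟩ := hEl
      have hPF := (isMaximalBinaryPath_of_mem_layer hP).subset_verts
      obtain ⟨A, hA, B, hB, hAB, huA, huB⟩ :=
        hs.exists_exit_of_notMem_pathNodes hT hPF hEP huE (hu.2 P hP)
      obtain ⟨A', hA', B', hB', hAB', hvA, hvB⟩ :=
        hs.exists_exit_of_notMem_pathNodes hT hPF hEP hvE (hv.2 P hP)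
      obtain rfl := hs.exit_unique hT hε hi hP hA hB hAB hA' hB' hAB' huA hvA hEP huE hvE
      exact ⟨B, (mem_verts_nextState hi).2 ⟨hAB.snd_mem, notMem_layer_of_exit hP hA hB hAB⟩,
        huB, hvB⟩
    · exact ⟨E, (mem_verts_nextState hi).2 ⟨hE, hEl⟩, huE, hvE⟩

lemma Reaches.isRegular [Finite V] (hT : IsCliqueForest G T) (hε : 0 < ε) (h : Reaches G T ε i s)
    (hi : i < kParam ε) : IsRegular s := by
  induction h with
  | init => exact isRegular_initState
  | step j s c _ _ _ ih => exact (ih (by omega)).isRegular_nextState hT hε hi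

end Invariants

/-! ### Connected pieces of a path -/

section Components

variable {V : Type*} {G : SimpleGraph V} {A H H' : Set V}

lemma IsComponent.subset (hH : IsComponent G A H) : H ⊆ A := by
  obtain ⟨K, rfl⟩ := hH
  rintro _ ⟨x, -, rfl⟩
  exact x.2

lemma IsComponent.mem_of_adj (hH : IsComponent G A H) {x y : V} (hx : x ∈ H) (hy : y ∈ A)
    (hxy : G.Adj x y) : y ∈ H := by
  obtain ⟨K, rfl⟩ := hH
  obtain ⟨x, hx, rfl⟩ := hx
  exact ⟨⟨y, hy⟩, K.mem_supp_of_adj_mem_supp hx hxy, rfl⟩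

lemma exists_isComponent_mem {x : V} (hx : x ∈ A) : ∃ H, IsComponent G A H ∧ x ∈ H :=
  ⟨_, ⟨(G.induce A).connectedComponentMk ⟨x, hx⟩, rfl⟩, ⟨⟨x, hx⟩, rfl, rfl⟩⟩

lemma IsComponent.eq_of_mem (hH : IsComponent G A H) (hH' : IsComponent G A H') {x : V}
    (hx : x ∈ H) (hx' : x ∈ H') : H = H' := by
  obtain ⟨K, rfl⟩ := hH
  obtain ⟨K', rfl⟩ := hH'
  obtain ⟨y, hy, rfl⟩ := hx
  obtain ⟨z, hz, hyz⟩ := hx'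
  obtain rfl : z = y := Subtype.ext hyz
  rw [SimpleGraph.ConnectedComponent.mem_supp_iff] at hy hz
  rw [← hy, ← hz]

lemma IsComponent.connected (hH : IsComponent G A H) : (G.induce H).Connected := by
  obtain ⟨K, rfl⟩ := hH
  let f : K.toSimpleGraph →g G.induce (Subtype.val '' K.supp) :=
    { toFun := fun x => ⟨x.1.1, x.1, x.2, rfl⟩
      map_rel' := fun h => h }
  refine K.connected_toSimpleGraph.map f ?_
  rintro ⟨_, x, hx, rfl⟩
  exact ⟨⟨x, hx⟩, rfl⟩

end Components

section Absorbing

variable {V : Type*} {G : SimpleGraph V} {T : SimpleGraph (MaxClique G)} {s : State G T} {ε : ℝ}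
  {i : ℕ} {P : Set (MaxClique G)} {H : Set V}

/-- If all nodes that leave the path from a neighbour of the piece `H` do so at the end `b`, the
greedy independent set of `H`, taken from the other end, is maximum and absorbing: the right ends
of its intervals pierce the trees of all nodes in its closed neighbourhood. -/
lemma IsRegular.exists_absorbing_of_end [Finite V] (hs : IsRegular s) (hT : IsCliqueForest G T)
    {a b : MaxClique G} {p : T.Walk a b} (hp : p.IsPath) (hP : P = {C | C ∈ p.support})
    (hH : IsComponent G (freeNodes s P) H)
    (hend : ∀ x ∈ s.U, x ∉ pathNodes s P → ∀ h ∈ H, G.Adj h x → x ∈ b.1) :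
    ∃ J ⊆ H, G.IsIndepSet J ∧ J.ncard = alpha G H ∧
      J.ncard = alpha G (closedNbhd G s.U J \ closedNbhd G univ s.I) := by
  classical
  have hHP : ∀ h ∈ H, h ∈ pathNodes s P := fun h hh => (hH.subset hh).1
  have hpos : ∀ {C : MaxClique G}, C ∈ P → ∃ i ≤ p.length, p.getVert i = C := by
    intro C hC
    rw [hP] at hC
    obtain ⟨i, hi, hil⟩ := SimpleGraph.Walk.mem_support_iff_exists_getVert.1 hC
    exact ⟨i, hil, hi⟩
  have hr : ∀ h ∈ H.toFinite.toFinset, IsGreatest (positions p h) (sSup (positions p h)) := by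
    intro h hh
    have hbdd : BddAbove (positions p h) := ⟨p.length, fun i hi => hi.1⟩
    obtain ⟨C, hC, hhC⟩ := hs.exists_mem_of_mem_pathNodes (hHP h (by simpa using hh))
    obtain ⟨i, hi, rfl⟩ := hpos hC
    exact ⟨Nat.sSup_mem ⟨i, hi, hhC⟩ hbdd, fun j hj => le_csSup hbdd hj⟩
  obtain ⟨J, hJH, hdis, hpierce⟩ := exists_disjoint_pierced (positions p)
    (fun h => sSup (positions p h)) (hT.ordConnected_positions hp) _ hr
  have hJH' : (J : Set V) ⊆ H := fun j hj => by simpa using hJH hj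
  have hind : G.IsIndepSet (J : Set V) := by
    intro x hx y hy hxy hadj
    obtain ⟨C, hC, hxC, hyC⟩ := hs.exists_common_path (hHP x (hJH' hx)) (hHP y (hJH' hy)).1 hadj
    obtain ⟨i, hi, rfl⟩ := hpos hC
    exact Set.disjoint_left.1 (hdis x hx y hy hxy) ⟨hi, hxC⟩ ⟨hi, hyC⟩
  have hJfree : ∀ j ∈ J, j ∈ freeNodes s P := fun j hj => hH.subset (hJH' hj)
  refine ⟨J, hJH', hind, le_antisymm (ncard_le_alpha hJH' hind) ?_,
    le_antisymm (ncard_le_alpha (fun j hj => ?_) hind) ?_⟩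
  · refine alpha_le_ncard_of_cover (J : Set V) (fun j => (p.getVert (sSup (positions p j))).1)
      (fun j _ => isClique_maxClique _) fun v hv => ?_
    obtain ⟨j, hj, hjv⟩ := hpierce v (by simpa using hv)
    exact ⟨j, hj, hjv.2⟩
  · exact ⟨⟨(hJfree j hj).1.1, Or.inl hj⟩, (hJfree j hj).2⟩
  · refine alpha_le_ncard_of_cover (J : Set V) (fun j => (p.getVert (sSup (positions p j))).1)
      (fun j _ => isClique_maxClique _) ?_
    rintro x ⟨⟨hxU, hxJ⟩, hxI⟩
    by_cases hxP : x ∈ pathNodes s P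
    · have hxH : x ∈ H := by
        rcases hxJ with hxJ | ⟨w, hw, hwx⟩
        · exact hJH' hxJ
        · exact hH.mem_of_adj (hJH' hw) ⟨hxP, hxI⟩ hwx
      obtain ⟨j, hj, hjx⟩ := hpierce x (by simpa using hxH)
      exact ⟨j, hj, hjx.2⟩
    · rcases hxJ with hxJ | ⟨w, hw, hwx⟩
      · exact absurd (hJfree x hxJ).1 hxP
      have hxb := hend x hxU hxP w (hJH' hw) hwx
      obtain ⟨C, hC, hwC, hxC⟩ := hs.exists_common_path (hHP w (hJH' hw)) hxU hwx
      obtain ⟨i, hi, rfl⟩ := hpos hC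
      have hg := hr w (hJH hw)
      have hmem : p.length ∈ positions p x := ⟨le_rfl, by simpa using hxb⟩
      exact ⟨w, hw, ((hT.ordConnected_positions hp x).out ⟨hi, hxC⟩ hmem
        ⟨hg.2 ⟨hi, hwC⟩, hg.1.1⟩).2⟩

/-- A remaining node outside `W_P` that has a neighbour in `W_P` leaves the path `P`. -/
lemma IsRegular.exists_exit_of_adj (hs : IsRegular s) (hT : IsCliqueForest G T)
    (hP : P ⊆ s.F.verts) {h x : V} (hh : h ∈ pathNodes s P) (hx : x ∈ s.U)
    (hxP : x ∉ pathNodes s P) (hadj : G.Adj h x) :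
    ∃ A ∈ P, ∃ B ∉ P, s.F.Adj A B ∧ x ∈ A.1 ∧ x ∈ B.1 := by
  obtain ⟨C, hC, -, hxC⟩ := hs.exists_common_path hh hx hadj
  exact hs.exists_exit_of_notMem_pathNodes hT hP hC hxC hxP

/-- In the iterations that require absorbing sets, a piece of small independence number has one:
otherwise nodes leave the path at both of its ends from neighbours of the piece, and the path has
small diameter since the piece has. -/
lemma IsRegular.exists_absorbing [Finite V] (hs : IsRegular s) (hT : IsCliqueForest G T)
    (hi : i < kParam ε) (hP : P ∈ layer ε i s) (hH : IsComponent G (freeNodes s P) H)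
    (hα : alpha G H < dParam ε) :
    ∃ J ⊆ H, G.IsIndepSet J ∧ J.ncard = alpha G H ∧
      J.ncard = alpha G (closedNbhd G s.U J \ closedNbhd G univ s.I) := by
  have hmax := isMaximalBinaryPath_of_mem_layer hP
  have hHP : ∀ h ∈ H, h ∈ pathNodes s P := fun h hh => (hH.subset hh).1
  rcases hP with hpen | ⟨-, ⟨-, hdiam⟩ | ⟨hik, -⟩⟩
  · obtain ⟨a, b, p, hp, hF, hPp, hexit⟩ := hpen.exists_walk
    refine hs.exists_absorbing_of_end hT hp hPp hH fun x hx hxP h hh hadj => ?_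
    obtain ⟨A, hA, B, hB, hAB, hxA, -⟩ :=
      hs.exists_exit_of_adj hT hmax.subset_verts (hHP h hh) hx hxP hadj
    obtain rfl := (hexit A hA B hB hAB).1
    exact hxA
  · obtain ⟨a, b, p, hp, hF, hPp⟩ := hmax.exists_walk
    have hab : ∀ x ∈ s.U, x ∉ pathNodes s P → ∀ h ∈ H, G.Adj h x → x ∈ a.1 ∨ x ∈ b.1 := by
      intro x hx hxP h hh hadj
      obtain ⟨A, hA, B, hB, hAB, hxA, -⟩ :=
        hs.exists_exit_of_adj hT hmax.subset_verts (hHP h hh) hx hxP hadj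
      rcases hmax.eq_end_of_adj hp hF hPp hA hB hAB with rfl | rfl
      · exact Or.inl hxA
      · exact Or.inr hxA
    by_cases hb : ∀ x ∈ s.U, x ∉ pathNodes s P → ∀ h ∈ H, G.Adj h x → x ∈ b.1
    · exact hs.exists_absorbing_of_end hT hp hPp hH hb
    by_cases ha : ∀ x ∈ s.U, x ∉ pathNodes s P → ∀ h ∈ H, G.Adj h x → x ∈ a.1
    · exact hs.exists_absorbing_of_end hT hp.reverse (by simpa using hPp) hH ha
    exfalso
    push Not at ha hb
    obtain ⟨x, hx, hxP, h, hh, hhx, hxb⟩ := hb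
    obtain ⟨y, hy, hyP, h', hh', hhy, hya⟩ := ha
    have hxa := (hab x hx hxP h hh hhx).resolve_right hxb
    have hyb := (hab y hy hyP h' hh' hhy).resolve_left hya
    have hadj : ∀ {u v : V}, u ∈ H → v ∈ s.U → G.Adj u v → (sharedGraph G s.U P).Adj u v := by
      intro u v hu hv huv
      exact ⟨huv.ne, (hHP u hu).1, hv, hs.exists_common_path (hHP u hu) hv huv⟩
    let f : G.induce H →g sharedGraph G s.U P :=
      { toFun := Subtype.val
        map_rel' := fun {u v} huv => hadj u.2 (hHP v v.2).1 huv }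
    obtain ⟨w, hw⟩ := hH.connected.exists_walk_length_eq_dist ⟨h, hh⟩ ⟨h', hh'⟩
    have hdist := dist_lt_two_mul_indepNum hH.connected ⟨h, hh⟩ ⟨h', hh'⟩
    -- A shortest path in `H` has at most `2 d - 3` edges, so `w'` has at most `2 d - 1`, and the
    -- path would have diameter at most `2 d + 1`.
    let w' : (sharedGraph G s.U P).Walk x y :=
      .cons (hadj hh hx hhx).symm (SimpleGraph.Walk.concat (v := h') (w.map f) (hadj hh' hy hhy))
    have hw' : w'.length = w.length + 2 := by
      simp only [w', SimpleGraph.Walk.length_cons]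
      rw [SimpleGraph.Walk.length_concat]
      exact congrArg (· + 1 + 1) (SimpleGraph.Walk.length_map _ _)
    have hle := hdiam.trans
      (hT.pathDiam_le hp hPp (hs.nodesOf_subset hmax.subset_verts) w' hxa hyb)
    rw [Nat.cast_le] at hle
    unfold alpha at hα
    omega
  · omega

/-- The algorithm does not get stuck. -/
lemma IsRegular.exists_isAllowedChoice [Finite V] (hs : IsRegular s) (hT : IsCliqueForest G T)
    (hε : 0 < ε) : ∃ c, IsAllowedChoice ε i s c := by
  have hex : ∀ P ∈ layer ε i s, ∀ H, IsComponent G (freeNodes s P) H →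
      ∃ J, IsAllowedPiece ε i s H J := by
    intro P hP H hH
    by_cases hab : alpha G H < dParam ε ∧ i < kParam ε
    · obtain ⟨J, hJ, hi, hc, ha⟩ := hs.exists_absorbing hT hab.2 hP hH hab.1
      exact ⟨J, hJ, hi, fun _ => ⟨hc, fun _ => ha⟩, fun h => absurd hab.1 (by omega)⟩
    · obtain ⟨J, hJ, hi, hc⟩ := exists_isIndepSet_ncard_eq_alpha G H
      refine ⟨J, hJ, hi, fun h => ⟨hc, fun h' => absurd ⟨h, h'⟩ hab⟩, fun _ => ?_⟩
      rw [hc]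
      have : (0 : ℝ) ≤ ε / 8 * alpha G H := by positivity
      linarith
  choose! c hc using hex
  exact ⟨c, hc⟩

end Absorbing

/-! ### The loss on a single path -/

section Charge

variable {V : Type*} {G : SimpleGraph V} {T : SimpleGraph (MaxClique G)} {s : State G T} {ε : ℝ}
  {i : ℕ} {P : Set (MaxClique G)} {H J : Set V} {c : Set (MaxClique G) → Set V → Set V}

/-- The nodes charged to a single connected piece `H` with independent set `J`. -/
def pieceNodes (ε : ℝ) (i : ℕ) (s : State G T) (H J : Set V) : Set V :=
  {v | v ∈ H ∨ (i < kParam ε ∧ v ∈ closedNbhd G s.U J \ closedNbhd G univ s.I)}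

lemma subset_closedNbhd_of_ncard_eq_alpha [Finite V] {U : Set V} (hHU : H ⊆ U) (hJH : J ⊆ H)
    (hJ : G.IsIndepSet J) (hc : J.ncard = alpha G H) : H ⊆ closedNbhd G U J := by
  intro v hv
  refine ⟨hHU hv, ?_⟩
  by_contra hcon
  push Not at hcon
  have hins : G.IsIndepSet (insert v J) := by
    refine hJ.insert fun w hw _ => ⟨fun h => hcon.2 w hw h.symm, fun h => hcon.2 w hw h⟩
  have := ncard_le_alpha (insert_subset hv hJH) hins
  rw [Set.ncard_insert_of_notMem hcon.1] at this
  omega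

lemma IsRegular.alpha_pieceNodes_le [Finite V] (hs : IsRegular s) (hT : IsCliqueForest G T)
    (hε : 0 < ε) (hε' : ε < 1 / 2) (hP : P ∈ layer ε i s)
    (hH : IsComponent G (freeNodes s P) H) (hJ : IsAllowedPiece ε i s H J) :
    (alpha G (pieceNodes ε i s H J) : ℝ) ≤ (1 + ε / 4) * (J.ncard : ℝ) := by
  obtain ⟨hJH, hind, hsmall, hlarge⟩ := hJ
  have hHU : H ⊆ s.U := fun h hh => (hH.subset hh).1.1
  have hJ0 : (0 : ℝ) ≤ ε / 4 * J.ncard := by positivity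
  rcases lt_or_ge (alpha G H) (dParam ε) with hα | hα
  · obtain ⟨hc, habs⟩ := hsmall hα
    have hle : alpha G (pieceNodes ε i s H J) ≤ J.ncard := by
      by_cases hik : i < kParam ε
      · rw [habs hik]
        refine alpha_mono ?_
        rintro v (hv | hv)
        · exact ⟨subset_closedNbhd_of_ncard_eq_alpha hHU hJH hind hc hv, (hH.subset hv).2⟩
        · exact hv.2
      · rw [hc]
        refine alpha_mono ?_
        rintro v (hv | hv)
        · exact hv
        · exact absurd hv.1 hik
    have : (alpha G (pieceNodes ε i s H J) : ℝ) ≤ J.ncard := by exact_mod_cast hle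
    linarith
  · have hlarge := hlarge hα
    have hmax := isMaximalBinaryPath_of_mem_layer hP
    obtain ⟨a, b, p, hp, hF, hPp⟩ := hmax.exists_walk
    -- The nodes outside `H` lie in one of the two end cliques of the path.
    have hsub : pieceNodes ε i s H J ⊆ H ∪ (a.1 ∪ b.1) := by
      rintro v (hv | ⟨-, ⟨hvU, hvJ⟩, hvI⟩)
      · exact Or.inl hv
      rcases hvJ with hvJ | ⟨w, hw, hwv⟩
      · exact Or.inl (hJH hvJ)
      have hwP := hH.subset (hJH hw)
      by_cases hvP : v ∈ pathNodes s P
      · exact Or.inl (hH.mem_of_adj (hJH hw) ⟨hvP, hvI⟩ hwv)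
      · obtain ⟨A, hA, B, hB, hAB, hvA, -⟩ :=
          hs.exists_exit_of_adj hT hmax.subset_verts hwP.1 hvU hvP hwv
        rcases hmax.eq_end_of_adj hp hF hPp hA hB hAB with rfl | rfl
        · exact Or.inr (Or.inl hvA)
        · exact Or.inr (Or.inr hvA)
    have h1 := alpha_mono (G := G) hsub
    have h2 := alpha_union_le (G := G) H (a.1 ∪ b.1)
    have h3 := alpha_union_le (G := G) a.1 b.1
    have h4 := alpha_le_one (isClique_maxClique a)
    have h5 := alpha_le_one (isClique_maxClique b)
    have h6 : (alpha G (pieceNodes ε i s H J) : ℝ) ≤ alpha G H + 2 := by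
      exact_mod_cast (by omega : alpha G (pieceNodes ε i s H J) ≤ alpha G H + 2)
    -- As `d ≥ 64 / ε`, the chosen set has at least `32 / ε` elements, which pays for the `2`.
    have h7 : 64 / ε ≤ (1 + ε / 8) * (J.ncard : ℝ) :=
      (Nat.le_ceil _).trans ((Nat.cast_le.2 hα).trans hlarge)
    have h8 : (1 + ε / 8) * (J.ncard : ℝ) ≤ 2 * J.ncard := by
      gcongr
      linarith
    have h9 : 64 ≤ 2 * J.ncard * ε := (div_le_iff₀ hε).1 (h7.trans h8)
    linarith

/-- On every peeled path at most a factor `1 + ε / 4` is lost. -/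
lemma IsRegular.alpha_chargedNodes_le [Finite V] (hs : IsRegular s) (hT : IsCliqueForest G T)
    (hε : 0 < ε) (hε' : ε < 1 / 2) (hP : P ∈ layer ε i s) (hc : IsAllowedChoice ε i s c) :
    (alpha G (chargedNodes ε i s c P) : ℝ) ≤ (1 + ε / 4) * ((pathSet s c P).ncard : ℝ) := by
  classical
  have := Fintype.ofFinite {H // IsComponent G (freeNodes s P) H}
  have hpath : pathSet s c P = ⋃ H : {H // IsComponent G (freeNodes s P) H}, c P H := by
    ext v
    simp [pathSet]
  have hsub : chargedNodes ε i s c P ⊆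
      ⋃ H : {H // IsComponent G (freeNodes s P) H}, pieceNodes ε i s H (c P H) := by
    rintro v ⟨hv | ⟨hik, hvU, hv⟩, hvI⟩
    · obtain ⟨H, hH, hvH⟩ := exists_isComponent_mem (G := G) (A := freeNodes s P) ⟨hv, hvI⟩
      exact mem_iUnion.2 ⟨⟨H, hH⟩, Or.inl hvH⟩
    · rcases hv with ⟨H, hH, hvH⟩ | ⟨w, ⟨H, hH, hwH⟩, hwv⟩
      · exact mem_iUnion.2 ⟨⟨H, hH⟩, Or.inl ((hc P hP H hH).1 hvH)⟩
      · exact mem_iUnion.2 ⟨⟨H, hH⟩, Or.inr ⟨hik, ⟨hvU, Or.inr ⟨w, hwH, hwv⟩⟩, hvI⟩⟩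
  have hdis : Pairwise (Function.onFun Disjoint
      fun H : {H // IsComponent G (freeNodes s P) H} => c P H) := by
    rintro ⟨H, hH⟩ ⟨H', hH'⟩ hne
    refine Set.disjoint_left.2 fun v hv hv' => hne (Subtype.ext ?_)
    exact hH.eq_of_mem hH' ((hc P hP H hH).1 hv) ((hc P hP H' hH').1 hv')
  calc (alpha G (chargedNodes ε i s c P) : ℝ)
      ≤ ∑ H : {H // IsComponent G (freeNodes s P) H},
          (alpha G (pieceNodes ε i s H (c P H)) : ℝ) := by
        exact_mod_cast (alpha_mono hsub).trans (alpha_iUnion_le _)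
    _ ≤ ∑ H : {H // IsComponent G (freeNodes s P) H}, (1 + ε / 4) * ((c P H).ncard : ℝ) :=
        Finset.sum_le_sum fun H _ =>
          hs.alpha_pieceNodes_le hT hε hε' hP H.2 (hc P hP H H.2)
    _ = (1 + ε / 4) * ((pathSet s c P).ncard : ℝ) := by
        rw [hpath, Set.ncard_iUnion_of_finite (fun _ => Set.toFinite _) hdis,
          finsum_eq_sum_of_fintype, ← Finset.mul_sum]
        push_cast
        rfl

end Charge

/-! ### Counting branch vertices -/

section Counting

variable {V : Type*} {G : SimpleGraph V} {T : SimpleGraph (MaxClique G)} {s : State G T} {ε : ℝ}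
  {i : ℕ} {c : Set (MaxClique G) → Set V → Set V}

/-- The number of vertices of degree at least three. -/
noncomputable def branchCount {W : Type*} {T : SimpleGraph W} (F : T.Subgraph) : ℕ :=
  {C | 3 ≤ deg F C}.ncard

lemma branchCount_le_ncard_leaves {W : Type*} [Finite W] {T : SimpleGraph W} (hT : T.IsAcyclic)
    (F : T.Subgraph) : branchCount F ≤ {C | deg F C = 1}.ncard :=
  (hT.anti F.spanningCoe_le).ncard_branch_le

/-- A vertex of degree two that is not peeled keeps its degree, so new leaves are former branch
vertices. -/
lemma three_le_deg_of_deg_nextState_eq_one [Finite V] (hi : i < kParam ε) {E : MaxClique G}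
    (hE : deg (nextState ε i s c).F E = 1) : 3 ≤ deg s.F E := by
  by_contra hlt
  rw [nextState_F hi] at hE
  obtain ⟨D, hD⟩ := Set.ncard_eq_one.1 hE
  have hED : (s.F.deleteVerts (⋃₀ layer ε i s)).Adj E D :=
    (hD ▸ mem_singleton D : D ∈ (s.F.deleteVerts (⋃₀ layer ε i s)).neighborSet E)
  rw [SimpleGraph.Subgraph.deleteVerts_adj] at hED
  obtain ⟨P, hP, hEP⟩ := IsMaximalBinaryPath.exists_mem hED.1 (by omega)
  have hPl : P ∉ layer ε i s := fun h => hED.2.1 ⟨P, h, hEP⟩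
  have hE2 := hP.deg_eq_two (fun h => hPl (Or.inl h)) hEP
  have hsub : s.F.neighborSet E ⊆ (s.F.deleteVerts (⋃₀ layer ε i s)).neighborSet E := by
    intro X hX
    refine SimpleGraph.Subgraph.deleteVerts_adj.2 ⟨hED.1, hED.2.1, hX.snd_mem, ?_, hX⟩
    by_cases hXP : X ∈ P
    · rintro ⟨Q, hQ, hXQ⟩
      exact hPl (hP.eq_of_mem (isMaximalBinaryPath_of_mem_layer hQ) hXP hXQ ▸ hQ)
    · exact notMem_layer_of_three_le_deg (hP.three_le_deg hEP hXP hX)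
  have := Set.ncard_le_ncard hsub
  unfold deg at hE hE2
  omega

/-- Every iteration halves the number of branch vertices: leaves and branch vertices of the new
forest are branch vertices of the old one, and there are no fewer leaves than branch vertices. -/
lemma two_mul_branchCount_nextState_le [Finite V] (hT : T.IsAcyclic) (hi : i < kParam ε) :
    2 * branchCount (nextState ε i s c).F ≤ branchCount s.F := by
  have hle := branchCount_le_ncard_leaves hT (nextState ε i s c).F
  have hsub : {C | 3 ≤ deg (nextState ε i s c).F C} ∪ {C | deg (nextState ε i s c).F C = 1} ⊆
      {C | 3 ≤ deg s.F C} := by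
    rintro C (hC | hC)
    · refine le_trans hC (Set.ncard_le_ncard fun D hD => ?_)
      rw [nextState_F hi] at hD
      exact (SimpleGraph.Subgraph.deleteVerts_adj.1 hD).2.2.2.2
    · exact three_le_deg_of_deg_nextState_eq_one hi hC
  have hdis : Disjoint {C | 3 ≤ deg (nextState ε i s c).F C}
      {C | deg (nextState ε i s c).F C = 1} := by
    rw [Set.disjoint_left]
    intro C (hC : 3 ≤ _) (hC' : _ = 1)
    omega
  have h := Set.ncard_le_ncard hsub
  rw [Set.ncard_union_eq hdis] at h
  unfold branchCount at *
  omega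

lemma Reaches.branchCount_mul_le [Finite V] (hT : IsCliqueForest G T) (h : Reaches G T ε i s)
    (hi : i < kParam ε) : branchCount s.F * 2 ^ i ≤ G.indepNum := by
  induction h with
  | init =>
    rw [pow_zero, mul_one]
    exact (branchCount_le_ncard_leaves hT.1 _).trans hT.ncard_leaves_le
  | step j s c _ _ _ ih =>
    have h1 := two_mul_branchCount_nextState_le (s := s) (c := c) hT.1 hi
    have h2 := ih (by omega)
    calc branchCount (nextState ε (j + 1) s c).F * 2 ^ (j + 1)
        = (2 * branchCount (nextState ε (j + 1) s c).F) * 2 ^ j := by ring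
      _ ≤ branchCount s.F * 2 ^ j := Nat.mul_le_mul_right _ h1
      _ ≤ G.indepNum := h2

/-- A forest has at most as many maximal internal paths as branch vertices: the highest vertex of
such a path has a neighbour above it, which is a branch vertex whose only lower neighbour lies on
the path. -/
lemma ncard_internal_le {W : Type*} [Finite W] {T : SimpleGraph W} (hT : T.IsAcyclic)
    (F : T.Subgraph) (R : Set (Set W)) (hR : ∀ P ∈ R, IsMaximalInternalPath F P) :
    R.ncard ≤ branchCount F := by
  obtain ⟨ht, hne, huniq⟩ := (hT.anti F.spanningCoe_le).exists_height
  have hex : ∀ P ∈ R, ∃ w, 3 ≤ deg F w ∧ ∃ v ∈ P, F.Adj v w ∧ ht v < ht w := by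
    intro P hP
    obtain ⟨hmax, hdeg⟩ := hR P hP
    obtain ⟨v, hv, hvmax⟩ := Set.exists_max_image P ht P.toFinite hmax.nonempty
    obtain ⟨x, y, hxy, hN⟩ := Set.ncard_eq_two.1 (hdeg v hv)
    have hx : F.Adj v x := (hN ▸ (by simp) : x ∈ F.neighborSet v)
    have hy : F.Adj v y := (hN ▸ (by simp) : y ∈ F.neighborSet v)
    have hup : ∃ w, F.Adj v w ∧ ht v < ht w := by
      by_contra hcon
      push Not at hcon
      exact hxy (huniq x y v hx.symm hy.symm (lt_of_le_of_ne (hcon x hx) (hne x v hx.symm))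
        (lt_of_le_of_ne (hcon y hy) (hne y v hy.symm)))
    obtain ⟨w, hvw, hlt⟩ := hup
    have hwP : w ∉ P := fun hw => absurd (hvmax w hw) (not_le.2 hlt)
    exact ⟨w, hmax.three_le_deg hv hwP hvw, v, hv, hvw, hlt⟩
  rcases R.eq_empty_or_nonempty with rfl | ⟨P₀, hP₀⟩
  · simp
  have : Nonempty W := ⟨(hex P₀ hP₀).choose⟩
  choose! f hf hv using hex
  refine Set.ncard_le_ncard_of_injOn f hf fun P hP Q hQ hPQ => ?_
  obtain ⟨v, hvP, hvw, hlt⟩ := hv P hP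
  obtain ⟨v', hvQ, hvw', hlt'⟩ := hv Q hQ
  rw [← hPQ] at hvw' hlt'
  obtain rfl := huniq v v' (f P) hvw hvw' hlt hlt'
  exact (hR P hP).1.eq_of_mem (hR Q hQ).1 hvP hvQ

lemma alpha_biUnion_le [Finite V] {ι : Type*} [Finite ι] (A : Set ι) (S : ι → Set V) {n : ℕ}
    (hn : ∀ a ∈ A, alpha G (S a) ≤ n) : alpha G (⋃ a ∈ A, S a) ≤ A.ncard * n := by
  classical
  have := Fintype.ofFinite A
  rw [biUnion_eq_iUnion]
  refine (alpha_iUnion_le _).trans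
    ((Finset.sum_le_card_nsmul _ _ n fun (a : A) _ => hn a.1 a.2).trans ?_)
  rw [Finset.card_univ, ← Nat.card_eq_fintype_card, Nat.card_coe_set_eq, smul_eq_mul]

/-- After the last iteration, every remaining node lies in a branch vertex of the forest or in a
clique of an internal path of small independence number. -/
lemma IsRegular.alpha_nextState_U_le [Finite V] (hs : IsRegular s) (hT : IsCliqueForest G T)
    (hε : 0 < ε) :
    alpha G (nextState ε (kParam ε) s c).U ≤ branchCount s.F * dParam ε := by
  set R := {P | IsMaximalBinaryPath s.F P ∧ P ∉ layer ε (kParam ε) s}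
  have hint : ∀ P ∈ R, IsMaximalInternalPath s.F P := fun P hP =>
    ⟨hP.1, fun C hC => hP.1.deg_eq_two (fun h => hP.2 (Or.inl h)) hC⟩
  have hα : ∀ P ∈ R, alpha G (nodesOf P) ≤ dParam ε - 1 := by
    intro P hP
    by_contra hcon
    refine hP.2 (Or.inr ⟨hint P hP, Or.inr ⟨rfl, ?_⟩⟩)
    unfold pathAlpha
    omega
  have hsub : (State.U (nextState ε (kParam ε) s c)) ⊆
      (⋃ C ∈ {C | 3 ≤ deg s.F C}, C.1) ∪ ⋃ P ∈ R, nodesOf P := by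
    intro v hv
    rw [mem_U_nextState] at hv
    obtain ⟨C, hC, hvC⟩ := (hs.mem_U_iff v).1 hv.1
    by_cases hdeg : 3 ≤ deg s.F C
    · exact Or.inl (mem_biUnion hdeg hvC)
    obtain ⟨P, hP, hCP⟩ := IsMaximalBinaryPath.exists_mem hC (by omega)
    by_cases hPl : P ∈ layer ε (kParam ε) s
    · obtain ⟨A, hA, B, hB, hAB, -, hvB⟩ :=
        hs.exists_exit_of_notMem_pathNodes hT hP.subset_verts hCP hvC (hv.2 P hPl)
      exact Or.inl (mem_biUnion (show B ∈ {C | 3 ≤ deg s.F C} from hP.three_le_deg hA hB hAB) hvB)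
    · exact Or.inr (mem_biUnion (show P ∈ R from ⟨hP, hPl⟩) ⟨C, hCP, hvC⟩)
  have h1 := alpha_biUnion_le (G := G) {C | 3 ≤ deg s.F C} (fun C : MaxClique G => C.1)
    (n := 1) fun C _ => alpha_le_one (isClique_maxClique C)
  have h2 := alpha_biUnion_le (G := G) R nodesOf hα
  have h3 := Nat.mul_le_mul_right (dParam ε - 1) (ncard_internal_le hT.1 s.F R hint)
  obtain ⟨n, hn⟩ : ∃ n, dParam ε = n + 1 := ⟨_, (Nat.sub_add_cancel (dParam_pos hε)).symm⟩
  rw [hn, Nat.add_sub_cancel] at h2 h3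
  calc alpha G (nextState ε (kParam ε) s c).U
      ≤ branchCount s.F * 1 + branchCount s.F * n :=
        (alpha_mono hsub).trans ((alpha_union_le _ _).trans (add_le_add h1 (h2.trans h3)))
    _ = branchCount s.F * dParam ε := by rw [hn]; ring

end Counting

/-! ### The parameters -/

lemma logb_nonneg_of_params {ε : ℝ} (hε : 0 < ε) (hε' : ε < 1 / 2) :
    0 ≤ Real.logb 2 ((dParam ε : ℝ) / ε) := by
  refine Real.logb_nonneg (by norm_num) ((one_le_div hε).2 ?_)
  have : (1 : ℝ) ≤ dParam ε := by exact_mod_cast dParam_pos hε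
  linarith

lemma kParam_pos {ε : ℝ} (hε : 0 < ε) (hε' : ε < 1 / 2) : 0 < kParam ε := by
  have := logb_nonneg_of_params hε hε'
  exact Nat.ceil_pos.2 (by linarith)

lemma four_mul_le_two_pow_kParam {ε : ℝ} (hε : 0 < ε) :
    4 * ((dParam ε : ℝ) / ε) ≤ 2 ^ kParam ε := by
  have hd : (0 : ℝ) < dParam ε / ε := div_pos (by exact_mod_cast dParam_pos hε) hε
  have h : Real.logb 2 ((dParam ε : ℝ) / ε) + 2 ≤ (kParam ε : ℝ) := Nat.le_ceil _
  have h2 := Real.rpow_le_rpow_of_exponent_le (x := 2) (by norm_num) h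
  rw [Real.rpow_add (by norm_num), Real.rpow_logb (by norm_num) (by norm_num) hd,
    Real.rpow_natCast] at h2
  norm_num at h2
  linarith

lemma exists_kParam_le :
    ∃ K : ℝ, 0 < K ∧ ∀ ε : ℝ, 0 < ε → ε < 1 / 2 → (kParam ε : ℝ) ≤ K * Real.log (1 / ε) := by
  have hl2 : 0 < Real.log 2 := Real.log_pos (by norm_num)
  refine ⟨12 / Real.log 2, by positivity, fun ε hε hε' => ?_⟩
  have h0 := logb_nonneg_of_params hε hε'
  have hk : (kParam ε : ℝ) < Real.logb 2 ((dParam ε : ℝ) / ε) + 2 + 1 :=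
    Nat.ceil_lt_add_one (by linarith)
  have hd : (dParam ε : ℝ) < 64 / ε + 1 := Nat.ceil_lt_add_one (by positivity)
  have hinv : 2 ≤ 1 / ε := by rw [le_div_iff₀ hε]; linarith
  have hdε : (dParam ε : ℝ) / ε ≤ 2 ^ 7 * (1 / ε) ^ 2 := by
    have : (dParam ε : ℝ) ≤ 128 * (1 / ε) := by
      have : 64 / ε = 64 * (1 / ε) := by ring
      linarith
    calc (dParam ε : ℝ) / ε = dParam ε * (1 / ε) := by ring
      _ ≤ 128 * (1 / ε) * (1 / ε) := by gcongr
      _ = 2 ^ 7 * (1 / ε) ^ 2 := by ring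
  have hpos : (0 : ℝ) < dParam ε / ε := div_pos (by exact_mod_cast dParam_pos hε) hε
  have hlog : Real.logb 2 ((dParam ε : ℝ) / ε) ≤ 7 + 2 * Real.logb 2 (1 / ε) := by
    refine (Real.logb_le_logb_of_le (by norm_num) hpos hdε).trans_eq ?_
    rw [Real.logb_mul (by norm_num) (by positivity), Real.logb_pow, Real.logb_pow,
      Real.logb_self_eq_one (by norm_num)]
    norm_num
  have hL : 1 ≤ Real.logb 2 (1 / ε) := by
    rw [Real.le_logb_iff_rpow_le (by norm_num) (by positivity)]
    simpa using hinv
  calc (kParam ε : ℝ) ≤ 12 * Real.logb 2 (1 / ε) := by linarith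
    _ = 12 / Real.log 2 * Real.log (1 / ε) := by rw [Real.logb]; ring

/-! ### The returned set -/

section Output

variable {V : Type*} {G : SimpleGraph V} {T : SimpleGraph (MaxClique G)} {s : State G T} {ε : ℝ}
  {i : ℕ} {P Q : Set (MaxClique G)} {c : Set (MaxClique G) → Set V → Set V}

lemma pathSet_subset (hP : P ∈ layer ε i s) (hc : IsAllowedChoice ε i s c) :
    pathSet s c P ⊆ freeNodes s P := by
  rintro v ⟨H, hH, hv⟩
  exact hH.subset ((hc P hP H hH).1 hv)

lemma isIndepSet_pathSet (hP : P ∈ layer ε i s) (hc : IsAllowedChoice ε i s c) :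
    G.IsIndepSet (pathSet s c P) := by
  rintro u ⟨H, hH, hu⟩ v ⟨H', hH', hv⟩ huv hadj
  obtain ⟨hsub, hind, -⟩ := hc P hP H hH
  have hsub' := (hc P hP H' hH').1
  obtain rfl := hH.eq_of_mem hH' (hH.mem_of_adj (hsub hu) (hH'.subset (hsub' hv)) hadj) (hsub' hv)
  exact hind hu hv huv hadj

/-- Nodes of the sets `W_P` and `W_Q` of different peeled paths are neither equal nor adjacent. -/
lemma IsRegular.eq_of_mem_pathNodes [Finite V] (hs : IsRegular s) (hP : P ∈ layer ε i s)
    (hQ : Q ∈ layer ε i s) {u v : V} (hu : u ∈ pathNodes s P) (hv : v ∈ pathNodes s Q)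
    (huv : u = v ∨ G.Adj u v) : P = Q := by
  have hex : ∃ C ∈ s.F.verts, u ∈ C.1 ∧ v ∈ C.1 := by
    rcases huv with rfl | huv
    · obtain ⟨C, hC, huC⟩ := (hs.mem_U_iff u).1 hu.1
      exact ⟨C, hC, huC, huC⟩
    · exact hs.exists_common u hu.1 v hv.1 huv
  obtain ⟨C, hC, huC, hvC⟩ := hex
  exact (isMaximalBinaryPath_of_mem_layer hP).eq_of_mem (isMaximalBinaryPath_of_mem_layer hQ)
    (hu.2 C hC huC) (hv.2 C hC hvC)

lemma subset_closedNbhd_univ {S : Set V} : S ⊆ closedNbhd G univ S := fun _ hv =>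
  ⟨trivial, Or.inl hv⟩

lemma IsRegular.isIndepSet_nextState [Finite V] (hs : IsRegular s) (hI : G.IsIndepSet s.I)
    (hc : IsAllowedChoice ε i s c) : G.IsIndepSet (nextState ε i s c).I := by
  have hnew : ∀ u ∈ s.I, ∀ P ∈ layer ε i s, ∀ v ∈ pathSet s c P, ¬ G.Adj u v := by
    intro u hu P hP v hv hadj
    exact (pathSet_subset hP hc hv).2 ⟨trivial, Or.inr ⟨u, hu, hadj⟩⟩
  rintro u (hu | hu) v (hv | hv) huv hadj
  · exact hI hu hv huv hadj
  · obtain ⟨P, hP, hv⟩ := mem_iUnion₂.1 hv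
    exact hnew u hu P hP v hv hadj
  · obtain ⟨P, hP, hu⟩ := mem_iUnion₂.1 hu
    exact hnew v hv P hP u hu hadj.symm
  · obtain ⟨P, hP, hu⟩ := mem_iUnion₂.1 hu
    obtain ⟨Q, hQ, hv⟩ := mem_iUnion₂.1 hv
    obtain rfl := hs.eq_of_mem_pathNodes hP hQ (pathSet_subset hP hc hu).1
      (pathSet_subset hQ hc hv).1 (Or.inr hadj)
    exact isIndepSet_pathSet hP hc hu hv huv hadj

lemma IsRegular.ncard_nextState_I [Finite V] [Fintype (layer ε i s)] (hs : IsRegular s)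
    (hc : IsAllowedChoice ε i s c) :
    (nextState ε i s c).I.ncard = s.I.ncard + ∑ P : layer ε i s, (pathSet s c P).ncard := by
  have hdis : Disjoint s.I (⋃ P ∈ layer ε i s, pathSet s c P) := by
    rw [Set.disjoint_left]
    intro v hv hv'
    obtain ⟨P, hP, hv'⟩ := mem_iUnion₂.1 hv'
    exact (pathSet_subset hP hc hv').2 (subset_closedNbhd_univ hv)
  have hpair : Pairwise (Function.onFun Disjoint fun P : layer ε i s => pathSet s c P) := by
    rintro ⟨P, hP⟩ ⟨Q, hQ⟩ hne
    refine Set.disjoint_left.2 fun v hv hv' => hne (Subtype.ext ?_)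
    exact hs.eq_of_mem_pathNodes hP hQ (pathSet_subset hP hc hv).1 (pathSet_subset hQ hc hv').1
      (Or.inl rfl)
  rw [nextState, Set.ncard_union_eq hdis, biUnion_eq_iUnion,
    Set.ncard_iUnion_of_finite (fun _ => Set.toFinite _) hpair, finsum_eq_sum_of_fintype]

/-- The nodes accounted for so far: those that are removed or dominated by `I`. -/
def covered (s : State G T) : Set V := {v | v ∉ s.U ∨ v ∈ closedNbhd G univ s.I}

lemma compl_nextState_subset :
    (nextState ε i s c).Uᶜ ⊆ covered s ∪ ⋃ P : layer ε i s, chargedNodes ε i s c P := by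
  intro v hv
  by_cases hcov : v ∈ covered s
  · exact Or.inl hcov
  simp only [covered, mem_ofPred_eq, not_or, not_not] at hcov
  rw [mem_compl_iff, mem_U_nextState] at hv
  push Not at hv
  obtain ⟨P, hP, hvP⟩ := hv hcov.1
  exact Or.inr (mem_iUnion.2 ⟨⟨P, hP⟩, Or.inl hvP, hcov.2⟩)

lemma covered_nextState_subset (hi : i < kParam ε) :
    covered (nextState ε i s c) ⊆ covered s ∪ ⋃ P : layer ε i s, chargedNodes ε i s c P := by
  rintro v (hv | ⟨-, hv⟩)
  · exact compl_nextState_subset hv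
  by_cases hcov : v ∈ covered s
  · exact Or.inl hcov
  simp only [covered, mem_ofPred_eq, not_or, not_not] at hcov
  have hex : ∃ P ∈ layer ε i s, v ∈ closedNbhd G s.U (pathSet s c P) := by
    rcases hv with (hv | hv) | ⟨w, hw | hw, hwv⟩
    · exact absurd (subset_closedNbhd_univ hv) hcov.2
    · obtain ⟨P, hP, hv⟩ := mem_iUnion₂.1 hv
      exact ⟨P, hP, hcov.1, Or.inl hv⟩
    · exact absurd ⟨trivial, Or.inr ⟨w, hw, hwv⟩⟩ hcov.2
    · obtain ⟨P, hP, hw⟩ := mem_iUnion₂.1 hw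
      exact ⟨P, hP, hcov.1, Or.inr ⟨w, hw, hwv⟩⟩
  obtain ⟨P, hP, hv⟩ := hex
  exact Or.inr (mem_iUnion.2 ⟨⟨P, hP⟩, Or.inr ⟨hi, hv⟩, hcov.2⟩)

lemma IsRegular.alpha_le_of_subset [Finite V] (hs : IsRegular s) (hT : IsCliqueForest G T)
    (hε : 0 < ε) (hε' : ε < 1 / 2) (hc : IsAllowedChoice ε i s c)
    (hcov : (alpha G (covered s) : ℝ) ≤ (1 + ε / 4) * s.I.ncard) {A : Set V}
    (hA : A ⊆ covered s ∪ ⋃ P : layer ε i s, chargedNodes ε i s c P) :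
    (alpha G A : ℝ) ≤ (1 + ε / 4) * (nextState ε i s c).I.ncard := by
  classical
  have := Fintype.ofFinite (layer ε i s)
  have h1 : (alpha G A : ℝ) ≤
      alpha G (covered s) + ∑ P : layer ε i s, (alpha G (chargedNodes ε i s c P) : ℝ) := by
    exact_mod_cast (alpha_mono hA).trans
      ((alpha_union_le _ _).trans (add_le_add le_rfl (alpha_iUnion_le _)))
  have h2 : ∑ P : layer ε i s, (alpha G (chargedNodes ε i s c P) : ℝ) ≤
      ∑ P : layer ε i s, (1 + ε / 4) * ((pathSet s c P).ncard : ℝ) :=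
    Finset.sum_le_sum fun P _ => hs.alpha_chargedNodes_le hT hε hε' P.2 hc
  rw [← Finset.mul_sum] at h2
  rw [hs.ncard_nextState_I hc]
  push_cast
  linarith

lemma Reaches.isIndepSet [Finite V] (hT : IsCliqueForest G T) (hε : 0 < ε)
    (h : Reaches G T ε i s) : G.IsIndepSet s.I := by
  induction h with
  | init => exact Set.pairwise_empty _
  | step j s c h hj hc ih => exact (h.isRegular hT hε hj).isIndepSet_nextState ih hc

lemma Reaches.alpha_covered_le [Finite V] (hT : IsCliqueForest G T) (hε : 0 < ε)
    (hε' : ε < 1 / 2) (h : Reaches G T ε i s) (hi : i < kParam ε) :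
    (alpha G (covered s) : ℝ) ≤ (1 + ε / 4) * s.I.ncard := by
  induction h with
  | init =>
    have : covered (initState G T) = ∅ := by simp [covered, initState, closedNbhd]
    rw [this]
    have h0 : alpha G ∅ ≤ 1 * 0 := by
      simpa using alpha_biUnion_le (G := G) (∅ : Set V) (fun _ => ∅) (n := 0) (by simp)
    have h0' : alpha G ∅ = 0 := by omega
    rw [h0']
    push_cast
    positivity
  | step j s c h hj hc ih =>
    exact (h.isRegular hT hε hj).alpha_le_of_subset hT hε hε' hc (ih hj)
      (covered_nextState_subset hi)

lemma Reaches.exists_last_step {n : ℕ} (h : Reaches G T ε n s) (hn : 0 < n) :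
    ∃ j s₀ c, n = j + 1 ∧ s = nextState ε n s₀ c ∧ Reaches G T ε j s₀ ∧
      IsAllowedChoice ε n s₀ c := by
  cases h with
  | init => exact absurd hn (lt_irrefl 0)
  | step j s₀ c h _ hc => exact ⟨j, s₀, c, rfl, rfl, h, hc⟩

lemma Reaches.output [Finite V] (hT : IsCliqueForest G T) (hε : 0 < ε) (hε' : ε < 1 / 2)
    (h : Reaches G T ε (kParam ε) s) :
    (alpha G s.U : ℝ) ≤ ε / 2 * (G.indepNum : ℝ) ∧
      G.IsIndepSet s.I ∧ (G.indepNum : ℝ) ≤ (1 + ε) * (s.I.ncard : ℝ) := by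
  have hI := h.isIndepSet hT hε
  obtain ⟨j, s₀, c, hj, rfl, h₀, hc⟩ := h.exists_last_step (kParam_pos hε hε')
  have hjk : j < kParam ε := by omega
  have hs₀ := h₀.isRegular hT hε hjk
  have hU : (alpha G (nextState ε (kParam ε) s₀ c).U : ℝ) ≤ ε / 2 * (G.indepNum : ℝ) := by
    have h1 : (alpha G (nextState ε (kParam ε) s₀ c).U : ℝ) ≤ branchCount s₀.F * dParam ε := by
      exact_mod_cast hs₀.alpha_nextState_U_le hT hε
    have h2 : (branchCount s₀.F : ℝ) * 2 ^ j ≤ G.indepNum := by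
      exact_mod_cast h₀.branchCount_mul_le hT hjk
    have h3 := four_mul_le_two_pow_kParam hε
    rw [hj, pow_succ] at h3
    have h4 : (dParam ε : ℝ) ≤ ε / 2 * 2 ^ j := by
      have : 2 * ((dParam ε : ℝ) / ε) ≤ 2 ^ j := by linarith
      calc (dParam ε : ℝ) = ε / 2 * (2 * (dParam ε / ε)) := by field_simp
        _ ≤ ε / 2 * 2 ^ j := by gcongr
    calc (alpha G (nextState ε (kParam ε) s₀ c).U : ℝ)
        ≤ branchCount s₀.F * (ε / 2 * 2 ^ j) := h1.trans (by gcongr)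
      _ = ε / 2 * (branchCount s₀.F * 2 ^ j) := by ring
      _ ≤ ε / 2 * (G.indepNum : ℝ) := by gcongr
  refine ⟨hU, hI, ?_⟩
  have hcompl := hs₀.alpha_le_of_subset hT hε hε' hc (h₀.alpha_covered_le hT hε hε' hjk)
    compl_nextState_subset
  have hsplit : (G.indepNum : ℝ) ≤ alpha G (nextState ε (kParam ε) s₀ c).U +
      alpha G (nextState ε (kParam ε) s₀ c).Uᶜ := by
    rw [← alpha_univ (G := G), ← union_compl_self (nextState ε (kParam ε) s₀ c).U]
    exact_mod_cast alpha_union_le _ _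
  set n : ℝ := ((nextState ε (kParam ε) s₀ c).I.ncard : ℝ)
  have hn : 0 ≤ n := Nat.cast_nonneg _
  -- `1 + ε / 4 ≤ (1 - ε / 2) * (1 + ε)` since `ε ≤ 1 / 2`.
  have hfac : (1 + ε / 4) * n ≤ (1 - ε / 2) * ((1 + ε) * n) := by
    rw [← mul_assoc]
    refine mul_le_mul_of_nonneg_right ?_ hn
    nlinarith
  refine le_of_mul_le_mul_left (a := 1 - ε / 2) ?_ (by linarith)
  linarith

end Output

end ChordalMIS

theorem theorem7p3 :
    -- The number of iterations is `O(log (1/ε))`.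
    (∃ K : ℝ, 0 < K ∧ ∀ ε : ℝ, 0 < ε → ε < 1 / 2 →
      (ChordalMIS.kParam ε : ℝ) ≤ K * Real.log (1 / ε)) ∧
    ∀ (ε : ℝ), 0 < ε → ε < 1 / 2 →
    ∀ {V : Type*} [Finite V] (G : SimpleGraph V), ChordalMIS.IsChordal G →
    ∀ T : SimpleGraph (ChordalMIS.MaxClique G), ChordalMIS.IsCliqueForest G T →
      -- No execution gets stuck: the required independent sets exist in every iteration.
      (∀ (i : ℕ) (s : ChordalMIS.State G T),
        ChordalMIS.Reaches G T ε i s → i < ChordalMIS.kParam ε →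
        ∃ c, ChordalMIS.IsAllowedChoice ε (i + 1) s c) ∧
      -- On every peeled path at most a factor `1 + ε/4` is lost.
      (∀ (i : ℕ) (s : ChordalMIS.State G T)
        (c : Set (ChordalMIS.MaxClique G) → Set V → Set V),
        ChordalMIS.Reaches G T ε i s → i < ChordalMIS.kParam ε →
        ChordalMIS.IsAllowedChoice ε (i + 1) s c →
        ∀ P ∈ ChordalMIS.layer ε (i + 1) s,
          (ChordalMIS.alpha G (ChordalMIS.chargedNodes ε (i + 1) s c P) : ℝ) ≤
            (1 + ε / 4) * ((ChordalMIS.pathSet s c P).ncard : ℝ)) ∧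
      -- Every execution leaves a graph of small independence number and returns a
      -- `(1 + ε)`-approximate maximum independent set.
      (∀ s : ChordalMIS.State G T, ChordalMIS.Reaches G T ε (ChordalMIS.kParam ε) s →
        (ChordalMIS.alpha G s.U : ℝ) ≤ ε / 2 * (G.indepNum : ℝ) ∧
        G.IsIndepSet s.I ∧ (G.indepNum : ℝ) ≤ (1 + ε) * (s.I.ncard : ℝ)) := by
  refine ⟨ChordalMIS.exists_kParam_le, fun ε hε hε' V _ G _ T hT => ⟨?_, ?_, ?_⟩⟩
  · exact fun i s h hi => (h.isRegular hT hε hi).exists_isAllowedChoice hT hε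
  · exact fun i s c h hi hc P hP =>
      (h.isRegular hT hε hi).alpha_chargedNodes_le hT hε hε' hP hc
  · exact fun s h => h.output hT hε hε'
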